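/- Let $\sigma_2=\begin{pmatrix}0&-i\\ i&0\end{pmatrix}$, $\sigma_3=\begin{pmatrix}1&0\\0&-1\end{pmatrix}$, let $\mathbf C$ be complex conjugation on $\mathbb C^2$, $\vec e_1={}^t(1,0)$, and $\langle u,v\rangle=\mathrm{Re}\int_{\mathbb R^3}{}^t(\mathbf Cu)\,v\,dx$. Assume: (H1) $\beta\in C^\infty(\mathbb R,\mathbb R)$ and $\beta(0)=0$. (H2) There is $\alpha\in(1,5)$ such that for every $k\in\mathbb N_0$ there is $C_k$ with $|\frac{d^k}{dv^k}\beta(v^2)|\le C_k|v|^{\alpha-k-1}$ for all real $v$ with $|v|\ge1$. (H3) $\mathcal O\subseteq(0,\infty)$ is an open interval and $\mathcal O\ni\omega\mapsto\phi_\omega\in\mathcal S(\mathbb R^3,\mathbb C)$ is a $C^\infty$ family (in the Schwartz topology) of positive radial solutions of $-\Delta u+\omega u+\beta(|u|^2)u=0$. (H4) $\frac{d}{d\omega}\|\phi_\omega\|_{L^2}^2>0$ for $\omega\in\mathcal O$. (H5) For $\omega\in\mathcal O$ the operator $L_+=-\Delta+\omega+\beta(\phi_\omega^2)+2\beta'(\phi_\omega^2)\phi_\omega^2$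 with domain $H^2(\mathbb R^3,\mathbb C)$ has exactly one negative eigenvalue, and $\ker L_+=\mathrm{Span}_{\mathbb C}\{\partial_{x_j}\phi_\omega: j=1,2,3\}$. For $\omega\in\mathcal O$, $v\in\mathbb R^3$ put $p_j(\omega,v)=\frac12\langle\Diamond_j u,u\rangle$, $1\le j\le4$, where $u=e^{\frac i2v\cdot x}\phi_\omega\vec e_1$, $\Diamond_a=-i\sigma_3\partial_{x_a}$ for $a\le3$ and $\Diamond_4=1$. By (H4) the map $(\omega,v)\mapsto p=(p_1,\dots,p_4)$ is injective with open image; for $p=p(\omega,v)$ set $\Phi_p=e^{\frac i2v\cdot x}\phi_\omega\vec e_1$, and let $\partial_{p_j}\Phi_p$ be its partial derivatives in $p$. For $\omega\in\mathcal O$ and $p=p(\omega,0)$, so that $\Phi_p=\phi_\omega\vec e_1$, let $\mathcal H_p$ be the $\mathbb R$-linear operator in $L^2(\mathbb R^3,\mathbb C^2)$ with domain $H^2(\mathbb R^3,\mathbb C^2)$, $$\mathcal H_pu=-i\sigma_3\big(-\Delta u+\omega u+\beta(|\Phi_p|^2)u+2\beta'(|\Phi_p|^2)\,\mathrm{Re}({}^t(\mathbf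 C\Phi_p)u)\,\Phi_p\big).$$ Then for every $\omega\in\mathcal O$, with $p=p(\omega,0)$: (1) The map $p\mapsto\Phi_p(x)$ has partial derivatives in $p_1,\dots,p_4$ at $p(\omega,0)$ for every $x\in\mathbb R^3$, the ten vectors $$\partial_{p_1}\Phi_p,\ \partial_{p_2}\Phi_p,\ \partial_{p_3}\Phi_p,\ \partial_{p_4}\Phi_p,\ \partial_{x_1}\Phi_p,\ \partial_{x_2}\Phi_p,\ \partial_{x_3}\Phi_p,\ i\sigma_2\mathbf C\Phi_p,\ \sigma_2\mathbf C\Phi_p,\ i\Phi_p$$ belong to $L^2(\mathbb R^3,\mathbb C^2)$ and are linearly independent over $\mathbb R$, and their real span is exactly the generalized kernel $N_g(\mathcal H_p)=\bigcup_{j\ge1}\ker(\mathcal H_p)^j$. (2) (Assumption 3 of Grillakis, Shatah and Strauss for the centralizer of $\{e^{ti\sigma_3}\}$ in $\mathbb R^3\times SO(4)$.) Identify $\mathbb C^2=\mathbb R^4$ and let $\exp(t(\tau,A))$, $(\tau,A)\in\mathbb R^3\times so(4)$, act on functions $u:\mathbb R^3\to\mathbb C^2$ by $x\mapsto e^{tA}u(x+t\tau)$.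 Then $$\Big\{\tfrac{d}{dt}\exp(t(\tau,A))\Phi_p\big|_{t=0}:\ (\tau,A)\in\mathbb R^3\times so(4),\ A\,i\sigma_3=i\sigma_3A\Big\}=\ker\mathcal H_p .$$ -/

import Mathlib

open MeasureTheory Set
open scoped SchwartzMap Laplacian LineDeriv ENNReal

noncomputable section

/-- The physical space `ℝ³`. -/
abbrev E3 : Type := EuclideanSpace ℝ (Fin 3)

/-- The fibre `ℂ²`; its real inner product is `Re (ᵗ(Cu) v)`. -/
abbrev C2 : Type := EuclideanSpace ℂ (Fin 2)

/-- `L²(ℝ³, F)`. -/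
abbrev L2 (F : Type) [NormedAddCommGroup F] : Type := Lp F 2 (volume : Measure E3)

/-- The `a`-th standard basis vector of `ℝ³`. -/
def e3 (a : Fin 3) : E3 := EuclideanSpace.single a (1 : ℝ)

/-! ### Sobolev space `H²` and the distributional derivatives of its elements -/

section Sobolev

variable {F : Type} [NormedAddCommGroup F] [NormedSpace ℂ F] [CompleteSpace F]

/-- `u ∈ H²(ℝ³, F)`. -/
def MemH2 (u : L2 F) : Prop :=
  TemperedDistribution.MemSobolev 2 2 (u : 𝓢'(E3, F))

/-- `w ∈ L²` is the distributional Laplacian of `u ∈ L²`. -/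
def IsLaplacian (u w : L2 F) : Prop :=
  (w : 𝓢'(E3, F)) = Δ (u : 𝓢'(E3, F))

/-- `w ∈ L²` is the distributional derivative `∂_{x_a} u` of `u ∈ L²`. -/
def IsPartial (a : Fin 3) (u w : L2 F) : Prop :=
  (w : 𝓢'(E3, F)) = ∂_{e3 a} (u : 𝓢'(E3, F))

end Sobolev

/-! ### Algebra on `ℂ²` -/

/-- The Pauli matrix `σ₂` acting on `ℂ²`. -/
def sigma2 (z : C2) : C2 := Matrix.toEuclideanLin !![0, -Complex.I; Complex.I, 0] z

/-- The Pauli matrix `σ₃` acting on `ℂ²`. -/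
def sigma3 (z : C2) : C2 := Matrix.toEuclideanLin !![(1 : ℂ), 0; 0, -1] z

/-- Complex conjugation `C` on `ℂ²`. -/
def conjC (z : C2) : C2 := WithLp.toLp 2 fun i => (starRingEnd ℂ) (z i)

/-- The vector `e₁ = ᵗ(1, 0)`. -/
def vecE1 : C2 := EuclideanSpace.single 0 (1 : ℂ)

/-! ### The hypotheses on the nonlinearity and on the ground states -/

/-- (H1): `β` is smooth and `β(0) = 0`. -/
def HypH1 (β : ℝ → ℝ) : Prop := β 0 = 0 ∧ ContDiff ℝ (⊤ : ℕ∞) β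

/-- (H2): growth of `β`. -/
def HypH2 (β : ℝ → ℝ) : Prop :=
  ∃ α : ℝ, 1 < α ∧ α < 5 ∧ ∀ k : ℕ, ∃ C : ℝ, ∀ v : ℝ, 1 ≤ |v| →
    |iteratedDeriv k (fun s : ℝ => β (s ^ 2)) v| ≤ C * |v| ^ (α - k - 1)

/-- `ω ↦ φ_ω` is a `C^∞` curve on `O` in the Fréchet space `⋂ₙ Σₙ(ℝ³, ℂ) = 𝓢(ℝ³, ℂ)`:
all successive derivatives exist in the Schwartz topology. -/
def SmoothFamily (O : Set ℝ) (φ : ℝ → 𝓢(E3, ℂ)) : Prop :=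
  ∃ D : ℕ → ℝ → 𝓢(E3, ℂ), D 0 = φ ∧
    ∀ k : ℕ, ∀ ω ∈ O, HasDerivAt (D k) (D (k + 1) ω) ω

/-- (H3): `O` is an open interval in `(0, ∞)` and `φ_ω`, `ω ∈ O`, is a smooth family of positive
radial solutions of `-Δu + ωu + β(|u|²)u = 0`. -/
structure HypH3 (β : ℝ → ℝ) (O : Set ℝ) (φ : ℝ → 𝓢(E3, ℂ)) : Prop where
  isOpen : IsOpen O
  interval : O.OrdConnected
  pos : O ⊆ Ioi 0
  smooth : SmoothFamily O φ
  positive : ∀ ω ∈ O, ∀ x : E3, (φ ω x).im = 0 ∧ 0 < (φ ω x).re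
  radial : ∀ ω ∈ O, ∀ x y : E3, ‖x‖ = ‖y‖ → φ ω x = φ ω y
  equation : ∀ ω ∈ O, ∀ x : E3,
    -(Δ (φ ω)) x + (ω : ℂ) * φ ω x + ((β (‖φ ω x‖ ^ 2) : ℝ) : ℂ) * φ ω x = 0

/-- (H4): `d/dω ‖φ_ω‖²_{L²} > 0` on `O`. -/
def HypH4 (O : Set ℝ) (φ : ℝ → 𝓢(E3, ℂ)) : Prop :=
  ∀ ω ∈ O, 0 < deriv (fun s : ℝ => ∫ x : E3, ‖φ s x‖ ^ 2) ω

/-- The graph of `L₊ = -Δ + ω + β(φ_ω²) + 2β'(φ_ω²)φ_ω²` with domain `H²(ℝ³, ℂ)`: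
`u ∈ H²` and `L₊ u = f`. -/
def LPlusGraph (β : ℝ → ℝ) (φ : ℝ → 𝓢(E3, ℂ)) (ω : ℝ) (u f : L2 ℂ) : Prop :=
  MemH2 u ∧ ∃ w : L2 ℂ, IsLaplacian u w ∧
    ∀ᵐ x : E3, f x = -w x +
      ((ω + β (‖φ ω x‖ ^ 2) + 2 * deriv β (‖φ ω x‖ ^ 2) * ‖φ ω x‖ ^ 2 : ℝ) : ℂ) * u x

/-- (H5): for `ω ∈ O` the operator `L₊` has exactly one negative eigenvalue, and
`ker L₊ = Span {∂_{x_j} φ_ω}`. -/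
def HypH5 (β : ℝ → ℝ) (O : Set ℝ) (φ : ℝ → 𝓢(E3, ℂ)) : Prop :=
  ∀ ω ∈ O,
    (∃! μ : ℝ, μ < 0 ∧ ∃ u : L2 ℂ, u ≠ 0 ∧ LPlusGraph β φ ω u ((μ : ℂ) • u)) ∧
    {u : L2 ℂ | LPlusGraph β φ ω u 0} =
      (Submodule.span ℂ (range fun j : Fin 3 =>
        (∂_{e3 j} (φ ω) : 𝓢(E3, ℂ)).toLp 2 (volume : Measure E3)) : Set (L2 ℂ))

/-! ### Solitary waves and the coordinates `p` -/

/-- `e^{(i/2) v·x} φ_ω(x) e₁`. -/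
def soliton (φ : ℝ → 𝓢(E3, ℂ)) (ω : ℝ) (v : E3) (x : E3) : C2 :=
  (Complex.exp (Complex.I / 2 * ((inner ℝ v x : ℝ) : ℂ)) * φ ω x) • vecE1

/-- `◇₁, …, ◇₄` (indexed from `0`): `◇_a = -iσ₃ ∂_{x_a}` for `a ≤ 3`, and `◇₄ = 1`. -/
def diamond (j : Fin 4) (u : E3 → C2) (x : E3) : C2 :=
  if h : (j : ℕ) < 3 then -(Complex.I • sigma3 (fderiv ℝ u x (e3 ⟨j, h⟩))) else u x

/-- `Π_j(u) = 2⁻¹ ⟨◇_j u, u⟩`, `1 ≤ j ≤ 4`. -/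
def charge (j : Fin 4) (u : E3 → C2) : ℝ :=
  2⁻¹ * ∫ x : E3, inner ℝ (diamond j u x) (u x)

/-- `(p₁, …, p₄)` as a function of `(ω, v)`. These are coordinates on the set of all values
of `p = (p₁, …, p₇)`, where `p₅ = p₆ = 0` and `p₇ = p₄`. -/
def pCoord (φ : ℝ → 𝓢(E3, ℂ)) (z : ℝ × E3) : Fin 4 → ℝ :=
  fun j => charge j (soliton φ z.1 z.2)

/-- `Φ_p` as a function of the coordinates `(p₁, …, p₄)`:
`Φ_p = e^{(i/2) v·x} φ_ω e₁` if `p = p(ω, v)` with `ω ∈ O`, `v ∈ ℝ³`. -/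
def PhiP (φ : ℝ → 𝓢(E3, ℂ)) (O : Set ℝ) (p : Fin 4 → ℝ) : E3 → C2 :=
  soliton φ (Function.invFunOn (pCoord φ) (O ×ˢ univ) p).1
    (Function.invFunOn (pCoord φ) (O ×ˢ univ) p).2

/-- `∂_{p_j} Φ_p`. -/
def dpPhi (φ : ℝ → 𝓢(E3, ℂ)) (O : Set ℝ) (p : Fin 4 → ℝ) (j : Fin 4) (x : E3) : C2 :=
  deriv (fun s : ℝ => PhiP φ O (p + s • Pi.single j 1) x) 0

/-- `∂_{x_a} Φ_p`. -/
def dxPhi (φ : ℝ → 𝓢(E3, ℂ)) (O : Set ℝ) (p : Fin 4 → ℝ) (a : Fin 3) (x : E3) : C2 :=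
  fderiv ℝ (PhiP φ O p) x (e3 a)

/-- The ten vectors `∂_{p_1}Φ_p, …, ∂_{p_4}Φ_p, ∂_{x_1}Φ_p, ∂_{x_2}Φ_p, ∂_{x_3}Φ_p,
iσ₂CΦ_p, σ₂CΦ_p, iΦ_p`. -/
def tangentVector (φ : ℝ → 𝓢(E3, ℂ)) (O : Set ℝ) (p : Fin 4 → ℝ) : Fin 10 → E3 → C2 :=
  ![dpPhi φ O p 0, dpPhi φ O p 1, dpPhi φ O p 2, dpPhi φ O p 3,
    dxPhi φ O p 0, dxPhi φ O p 1, dxPhi φ O p 2,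
    fun x => Complex.I • sigma2 (conjC (PhiP φ O p x)),
    fun x => sigma2 (conjC (PhiP φ O p x)),
    fun x => Complex.I • PhiP φ O p x]

/-! ### The linearized operator -/

/-- The nonlinearity `z ↦ β(|z|²) z` on `ℂ²`, so that `∇E(u) = -Δu + nonlin β u`. -/
def nonlin (β : ℝ → ℝ) (z : C2) : C2 := β (‖z‖ ^ 2) • z

/-- The graph of `H_p = -iσ₃(∇²E(Φ_p) - λ(p)·◇)`, `p = p(ω, v)`, with domain `H²(ℝ³, ℂ²)`:
`u ∈ H²` and `H_p u = f`. Here `w = Δu`, `d a = ∂_{x_a} u`,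
`∇²E(Φ)u = -Δu + D(nonlin β)(Φ)u`, and `λ(p) = (-v, -ω - |v|²/4, 0, 0, 0)`. -/
def HGraph (β : ℝ → ℝ) (φ : ℝ → 𝓢(E3, ℂ)) (ω : ℝ) (v : E3) (u f : L2 C2) : Prop :=
  MemH2 u ∧ ∃ (w : L2 C2) (d : Fin 3 → L2 C2), IsLaplacian u w ∧ (∀ a, IsPartial a u (d a)) ∧
    ∀ᵐ x : E3, f x = -(Complex.I • sigma3
      (-w x + fderiv ℝ (nonlin β) (soliton φ ω v x) (u x)
        - (∑ a : Fin 3, (-v a) • (-(Complex.I • sigma3 (d a x)))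
            + (-ω - ‖v‖ ^ 2 / 4) • u x)))

/-- `ker (H_p)^n` for the unbounded operator `H_p`: `u` is in the domain and
`H_p u ∈ ker (H_p)^(n-1)`. -/
def kerPow (β : ℝ → ℝ) (φ : ℝ → 𝓢(E3, ℂ)) (ω : ℝ) (v : E3) : ℕ → Set (L2 C2)
  | 0 => {0}
  | n + 1 => {u | ∃ f ∈ kerPow β φ ω v n, HGraph β φ ω v u f}

/-- The generalized kernel `N_g(H_p) = ⋃_{j ≥ 1} ker (H_p)^j`. -/
def genKer (β : ℝ → ℝ) (φ : ℝ → 𝓢(E3, ℂ)) (ω : ℝ) (v : E3) : Set (L2 C2) :=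
  ⋃ j : ℕ, kerPow β φ ω v (j + 1)

/-! ### The infinitesimal orbit of the centralizer of `iσ₃` in `ℝ³ × SO(4)` -/

/-- `A ∈ so(4)`, where `ℂ² = ℝ⁴`, i.e. `A` is real linear and skew for the real inner product. -/
def IsSo4 (A : C2 →L[ℝ] C2) : Prop :=
  ∀ z w : C2, inner ℝ (A z) w = -inner ℝ z (A w)

/-- `A` commutes with `iσ₃`. -/
def CommutesISigma3 (A : C2 →L[ℝ] C2) : Prop :=
  ∀ z : C2, A (Complex.I • sigma3 z) = Complex.I • sigma3 (A z)

/-- The action of `exp (t (τ, A))`, `(τ, A) ∈ ℝ³ × so(4)`: translations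
`u ↦ u(· + tτ)` and multiplication by `e^{tA}`. -/
def orbitCurve (τ : E3) (A : C2 →L[ℝ] C2) (u : E3 → C2) (t : ℝ) (x : E3) : C2 :=
  NormedSpace.exp (t • A) (u (x + t • τ))

/-- `Z`: all the velocities at `t = 0` of the curves `exp (tϖ) u`, for `ϖ = (τ, A) ∈ ℝ³ × so(4)`
commuting with `iσ₃`. -/
def orbitTangent (u : E3 → C2) : Set (L2 C2) :=
  {z | ∃ (τ : E3) (A : C2 →L[ℝ] C2), IsSo4 A ∧ CommutesISigma3 A ∧
    ∀ᵐ x : E3, HasDerivAt (fun t : ℝ => orbitCurve τ A u t x) (z x) 0}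

end

/-! At `v = 0` write u = (a + ib, z) with a, b real and z complex. Since Φ = (φ, 0) with φ real, the
term with β' sees only a, and H u = (L₋b - iL₊a, iL₋z), where L₋ = -Δ + ω + β(φ²). Everything thus
reduces to the two scalar Schrödinger operators L₊ and L₋.

Their kernels are known. (H5) gives ker L₊ = span of the ∂_jφ. For L₋ the positivity of φ is used
through the ground state substitution s = φg: formally ∫ φ²|∇g|² = ∫ s̄ L₋s, so an element of the
kernel has ∇(u/φ) = 0 and is a multiple of φ (`eq_smul_of_isLaplacian`). As elements of the domain
are only H² functions, this is done with cutoffs on Schwartz approximations in the graph norm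
(`IsLaplacian.exists_schwartz_tendsto`).

Two further identities give the generalized eigenvectors: L₊φ' = -φ, where φ' = ∂_ωφ, and L₋(x_jφ) =
-2∂_jφ. The candidate for the generalized kernel is the ten-dimensional real space of "waves" (∑
r_j∂_jφ + sφ' + i(∑ t_jx_jφ + qφ), cφ). On it H acts by (r, s, t, q, c) ↦ (-2t, 0, 0, s, 0), so H² =
0 there (`hGraph_wave`). Conversely each H-preimage of a wave is a wave (`HGraph.exists_eq_wave`):
orthogonality of the range to the kernel forces s = 0, t = 0, c = 0 on the right-hand side, because
∫φφ' ≠ 0 by (H4) and ∫φ² ≠ 0. Hence the Jordan chains stop at length two, and ker H consists of the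
waves with s = 0 and t = 0.

It remains to recognize these spaces. From p_j = v_j‖φ‖²/4 and p₄ = ‖φ‖²/2 the p-derivatives of Φ_p
are nonzero multiples of (ix_jφ, 0) and (φ', 0), so the ten tangent vectors are a basis of the
waves. The group orbit produces exactly the waves with s = 0 and t = 0, since so(4) acts on Φ only
through A e₁. -/

noncomputable section

open Filter Topology

/-! ### Distributional Laplacians in L² and approximation in the graph norm -/

section Sobolev

variable {F : Type} [NormedAddCommGroup F] [NormedSpace ℂ F]

/-- The class in `L²` of a Schwartz function. -/
abbrev toL2 (f : 𝓢(E3, F)) : L2 F := f.toLp 2 (volume : Measure E3)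

/-- The Bessel potential of order two is `1 - (2π)⁻²Δ`. -/
theorem besselPotential_two_eq (f : 𝓢'(E3, F)) :
    TemperedDistribution.besselPotential E3 F 2 f = f - (((2 * Real.pi) ^ 2)⁻¹ : ℝ) • Δ f := by
  have h1 : (fun x : E3 => (((1 + ‖x‖ ^ 2) ^ ((2 : ℝ) / 2) : ℝ) : ℂ)) =
      (fun _ : E3 => (1 : ℂ)) + fun x : E3 => ((‖x‖ ^ 2 : ℝ) : ℂ) := by
    ext x
    simp
  have h2 : TemperedDistribution.besselPotential E3 F 2 f = f +
      TemperedDistribution.fourierMultiplierCLM F (fun x : E3 => ((‖x‖ ^ 2 : ℝ) : ℂ)) f := by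
    rw [TemperedDistribution.besselPotential, h1, TemperedDistribution.fourierMultiplierCLM_apply,
      TemperedDistribution.smulLeftCLM_add (by fun_prop) (by fun_prop)]
    simp [TemperedDistribution.fourierMultiplierCLM_apply]
  rw [h2, TemperedDistribution.laplacian_eq_fourierMultiplierCLM, smul_smul]
  have : ((2 * Real.pi) ^ 2)⁻¹ * -(2 * Real.pi) ^ 2 = -1 := by
    have := Real.pi_pos
    field_simp
  rw [this, neg_one_smul, sub_neg_eq_add]

variable [CompleteSpace F]

theorem isLaplacian_iff {u w : L2 F} :
    IsLaplacian u w ↔ ∀ ψ : 𝓢(E3, ℂ), ∫ x, ψ x • w x = ∫ x, (Δ ψ) x • u x := by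
  rw [IsLaplacian]
  constructor
  · intro h ψ
    have := congrArg (fun T : 𝓢'(E3, F) => T ψ) h
    simpa [TemperedDistribution.laplacian_apply_apply] using this
  · intro h
    ext ψ
    simpa [TemperedDistribution.laplacian_apply_apply] using h ψ

theorem toTemperedDistribution_injective :
    Function.Injective (Lp.toTemperedDistribution : L2 F → 𝓢'(E3, F)) := by
  have := (LinearMap.ker_eq_bot (f := ((Lp.toTemperedDistributionCLM F
    (volume : Measure E3) 2 : L2 F →L[ℂ] 𝓢'(E3, F)) : L2 F →ₗ[ℂ] 𝓢'(E3, F)))).1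
    Lp.ker_toTemperedDistributionCLM_eq_bot
  exact this

theorem IsLaplacian.besselPotential_eq {u w : L2 F} (h : IsLaplacian u w) :
    TemperedDistribution.besselPotential E3 F 2 (u : 𝓢'(E3, F)) =
      ((u - (((2 * Real.pi) ^ 2)⁻¹ : ℝ) • w : L2 F) : 𝓢'(E3, F)) := by
  rw [besselPotential_two_eq, ← h]
  simp only [← Lp.toTemperedDistributionCLM_apply, map_sub]
  congr 1
  exact (ContinuousLinearMap.map_smul_of_tower _ _ _).symm

/-- An L² Laplacian is all that H² requires, so the domain condition never has to be checked
separately. -/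
theorem IsLaplacian.memH2 {u w : L2 F} (h : IsLaplacian u w) : MemH2 u :=
  ⟨_, h.besselPotential_eq⟩

theorem isLaplacian_toLp (f : 𝓢(E3, F)) : IsLaplacian (toL2 f) (toL2 (Δ f)) := by
  rw [IsLaplacian, Lp.toTemperedDistribution_toLp_eq, Lp.toTemperedDistribution_toLp_eq,
    TemperedDistribution.laplacian_toTemperedDistributionCLM_eq]

theorem isPartial_toLp (a : Fin 3) (f : 𝓢(E3, F)) :
    IsPartial a (toL2 f) (toL2 (∂_{e3 a} f : 𝓢(E3, F))) := by
  rw [IsPartial, Lp.toTemperedDistribution_toLp_eq, Lp.toTemperedDistribution_toLp_eq,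
    TemperedDistribution.lineDerivOp_toTemperedDistributionCLM_eq]

end Sobolev


theorem e3_eq_basisFun : e3 = EuclideanSpace.basisFun (Fin 3) ℝ := by
  ext a i
  simp [e3]

theorem laplacian_eq_sum_e3 {F : Type*} [NormedAddCommGroup F] [NormedSpace ℝ F]
    (f : 𝓢(E3, F)) : Δ f = ∑ j, ∂_{e3 j} (∂_{e3 j} f) := by
  rw [e3_eq_basisFun]
  exact SchwartzMap.laplacian_eq_sum _ f

theorem toL2_add (f g : 𝓢(E3, ℂ)) : toL2 (f + g) = toL2 f + toL2 g :=
  (SchwartzMap.toLpCLM ℂ ℂ 2 (volume : Measure E3)).map_add f g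

theorem toL2_sub (f g : 𝓢(E3, ℂ)) : toL2 (f - g) = toL2 f - toL2 g :=
  (SchwartzMap.toLpCLM ℂ ℂ 2 (volume : Measure E3)).map_sub f g

theorem toL2_real_smul (c : ℝ) (f : 𝓢(E3, ℂ)) :
    toL2 (c • f) = c • toL2 f :=
  (SchwartzMap.toLpCLM ℝ ℂ 2 (volume : Measure E3)).map_smul c f

theorem toL2_smul (c : ℂ) (f : 𝓢(E3, ℂ)) :
    toL2 (c • f) = c • toL2 f :=
  (SchwartzMap.toLpCLM ℂ ℂ 2 (volume : Measure E3)).map_smul c f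

theorem integral_inner_laplacian_nonpos (s : 𝓢(E3, ℂ)) :
    ∫ x, inner ℝ (s x) ((Δ s) x) ≤ 0 := by
  have h : ∀ j : Fin 3, ∫ x, inner ℝ (s x) ((∂_{e3 j} (∂_{e3 j} s)) x) =
      -∫ x, inner ℝ ((∂_{e3 j} s) x) ((∂_{e3 j} s) x) := fun j =>
    SchwartzMap.integral_bilinear_lineDerivOp_right_eq_neg_left s (∂_{e3 j} s) (innerSL ℝ) (e3 j)
  rw [laplacian_eq_sum_e3]
  have hi : ∀ j : Fin 3, Integrable fun x => inner ℝ (s x) ((∂_{e3 j} (∂_{e3 j} s)) x) := fun j =>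
    (SchwartzMap.pairing (innerSL ℝ) s (∂_{e3 j} (∂_{e3 j} s))).integrable
  calc ∫ x, inner ℝ (s x) ((∑ j, ∂_{e3 j} (∂_{e3 j} s)) x)
      = ∑ j, ∫ x, inner ℝ (s x) ((∂_{e3 j} (∂_{e3 j} s)) x) := by
        rw [← integral_finsetSum _ fun j _ => hi j]
        congr 1
        ext x
        rw [← inner_sum, sum_apply]
    _ ≤ 0 := by
        refine Finset.sum_nonpos fun j _ => ?_
        rw [h j, neg_nonpos]
        exact integral_nonneg fun x => real_inner_self_nonneg

/-- Since ⟨s, Δs⟩ ≤ 0, pairing s - cΔs with s gives at least ‖s‖², and Cauchy–Schwarz concludes: the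
resolvent of Δ is a contraction. -/
theorem norm_toLp_le_norm_sub_laplacian (s : 𝓢(E3, ℂ)) {c : ℝ} (hc : 0 ≤ c) :
    ‖toL2 s‖ ≤ ‖toL2 (s - c • Δ s)‖ := by
  have h1 : inner ℝ (toL2 s) (toL2 (Δ s)) ≤ 0 := by
    rw [L2.inner_def]
    refine le_of_eq_of_le (integral_congr_ae ?_) (integral_inner_laplacian_nonpos s)
    filter_upwards [s.coeFn_toLp 2, (Δ s).coeFn_toLp 2] with x h1 h2
    rw [h1, h2]
  rw [toL2_sub, toL2_real_smul]
  set a := toL2 s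
  set b := toL2 (Δ s)
  have h2 : ‖a‖ ^ 2 ≤ ‖a‖ * ‖a - c • b‖ := by
    refine le_trans ?_ (real_inner_le_norm a (a - c • b))
    rw [inner_sub_right, inner_smul_right, real_inner_self_eq_norm_sq]
    nlinarith
  rcases (norm_nonneg a).eq_or_lt with h | h
  · rw [← h]
    positivity
  · exact le_of_mul_le_mul_left (by linarith) h

/-- With the normalization of the Fourier transform, 1 - (2π)⁻²Δ has symbol 1 + ‖ξ‖², whose inverse
is again a multiplier of the Schwartz space. -/
theorem exists_sub_laplacian_eq (g : 𝓢(E3, ℂ)) :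
    ∃ s : 𝓢(E3, ℂ), s - (((2 * Real.pi) ^ 2)⁻¹ : ℝ) • Δ s = g := by
  have ht := Function.hasTemperateGrowth_one_add_norm_sq_rpow E3 (-1)
  refine ⟨SchwartzMap.fourierMultiplierCLM ℂ (fun x : E3 => ((1 + ‖x‖ ^ 2) ^ (-1 : ℝ) : ℝ)) g, ?_⟩
  set s := SchwartzMap.fourierMultiplierCLM ℂ (fun x : E3 => ((1 + ‖x‖ ^ 2) ^ (-1 : ℝ) : ℝ)) g
  have hc : ((2 * Real.pi) ^ 2)⁻¹ * -(2 * Real.pi) ^ 2 = -1 := by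
    have := Real.pi_pos
    field_simp
  rw [SchwartzMap.laplacian_eq_fourierMultiplierCLM, smul_smul, hc, neg_one_smul, sub_neg_eq_add]
  have h1 : SchwartzMap.fourierMultiplierCLM ℂ ((fun _ : E3 => (1 : ℝ)) + fun x : E3 => ‖x‖ ^ 2) s =
      s + SchwartzMap.fourierMultiplierCLM ℂ (fun x : E3 => ‖x‖ ^ 2) s := by
    rw [SchwartzMap.fourierMultiplierCLM_apply,
      SchwartzMap.smulLeftCLM_add (by fun_prop) (by fun_prop)]
    simp [SchwartzMap.fourierMultiplierCLM_apply]
  rw [← h1, SchwartzMap.fourierMultiplierCLM_fourierMultiplierCLM_apply (by fun_prop) ht]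
  have h2 : (((fun _ : E3 => (1 : ℝ)) + fun x : E3 => ‖x‖ ^ 2) * fun x : E3 =>
      ((1 + ‖x‖ ^ 2) ^ (-1 : ℝ) : ℝ)) = fun _ => 1 := by
    ext x
    have : (1 + ‖x‖ ^ 2) ≠ 0 := by positivity
    simp [Real.rpow_neg_one, this]
  rw [h2]
  simp

theorem IsLaplacian.of_tendsto {u w : ℕ → L2 ℂ} {u₀ w₀ : L2 ℂ} (h : ∀ n, IsLaplacian (u n) (w n))
    (hu : Tendsto u atTop (𝓝 u₀)) (hw : Tendsto w atTop (𝓝 w₀)) : IsLaplacian u₀ w₀ := by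
  have h1 := ((Lp.toTemperedDistributionCLM ℂ (volume : Measure E3) 2).continuous.tendsto w₀).comp hw
  have h2 := (((LineDeriv.laplacianCLM ℂ E3 𝓢'(E3, ℂ)).continuous.comp
    (Lp.toTemperedDistributionCLM ℂ (volume : Measure E3) 2).continuous).tendsto u₀).comp hu
  rw [IsLaplacian, ← TemperedDistribution.laplacianCLM_apply]
  refine tendsto_nhds_unique h1 (Tendsto.congr (fun n => ?_) h2)
  simp only [Function.comp_apply, TemperedDistribution.laplacianCLM_apply,
    Lp.toTemperedDistributionCLM_apply]
  exact (h n).symm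

/-- An `L²` function with an `L²` Laplacian is approximated in the graph norm by Schwartz
functions. -/
theorem IsLaplacian.exists_schwartz_tendsto {u w : L2 ℂ} (h : IsLaplacian u w) :
    ∃ s : ℕ → 𝓢(E3, ℂ), Tendsto (fun n => toL2 (s n)) atTop (𝓝 u) ∧
      Tendsto (fun n => toL2 (Δ (s n))) atTop (𝓝 w) := by
  set c : ℝ := ((2 * Real.pi) ^ 2)⁻¹ with hc
  have hc0 : 0 < c := by positivity
  set f : L2 ℂ := u - c • w with hf
  -- Density is applied to f = (1 - cΔ)u rather than to u. Solving (1 - cΔ)sₙ = gₙ then makes sₙ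
  -- Cauchy by contraction, and Δsₙ converges because it is a combination of sₙ and gₙ.
  obtain ⟨G, hG, hGf⟩ := mem_closure_iff_seq_limit.1
    ((SchwartzMap.denseRange_toLpCLM (F := ℂ) (μ := (volume : Measure E3))
      (ENNReal.ofNat_ne_top (n := 2))) f)
  choose g hg using hG
  choose s hs using fun n => exists_sub_laplacian_eq (g n)
  have hgt : Tendsto (fun n => toL2 (g n)) atTop (𝓝 f) := by
    refine hGf.congr fun n => ?_
    rw [← hg n]
    rfl
  have hle : ∀ n m, ‖toL2 (s n) - toL2 (s m)‖ ≤
      ‖toL2 (g n) - toL2 (g m)‖ := fun n m => by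
    rw [← toL2_sub, ← toL2_sub]
    refine (norm_toLp_le_norm_sub_laplacian (s n - s m) hc0.le).trans_eq ?_
    congr 2
    rw [← hs n, ← hs m, ← SchwartzMap.laplacianCLM_eq', map_sub, smul_sub]
    simp only [SchwartzMap.laplacianCLM_eq']
    abel
  have hcau : CauchySeq fun n => toL2 (s n) := by
    have := hgt.cauchySeq
    rw [Metric.cauchySeq_iff] at this ⊢
    intro ε hε
    obtain ⟨N, hN⟩ := this ε hε
    refine ⟨N, fun m hm n hn => ?_⟩
    have := hN m hm n hn
    rw [dist_eq_norm] at this ⊢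
    exact (hle m n).trans_lt this
  obtain ⟨u', hu'⟩ := cauchySeq_tendsto_of_complete hcau
  have hw' : Tendsto (fun n => toL2 (Δ (s n))) atTop
      (𝓝 (c⁻¹ • (u' - f))) := by
    refine ((hu'.sub hgt).const_smul c⁻¹).congr fun n => ?_
    rw [← toL2_sub, ← toL2_real_smul]
    congr 1
    rw [← hs n, sub_sub_cancel, smul_smul, inv_mul_cancel₀ hc0.ne', one_smul]
  -- The limit u' satisfies (1 - cΔ)u' = f, as u does. The Bessel potential is invertible on
  -- tempered distributions, hence u' = u.
  have hL := IsLaplacian.of_tendsto (fun n => isLaplacian_toLp (s n)) hu' hw'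
  have hbu := h.besselPotential_eq
  have hbu' := hL.besselPotential_eq
  rw [← hc, smul_smul, mul_inv_cancel₀ hc0.ne', one_smul, sub_sub_cancel] at hbu'
  rw [← hc, ← hf, ← hbu', ← TemperedDistribution.besselPotential_neg_apply_eq_iff] at hbu
  have hbu2 := (TemperedDistribution.besselPotential_neg_apply_eq_iff 2 _ (u' : 𝓢'(E3, ℂ))).2 rfl
  have huu : u' = u := toTemperedDistribution_injective (hbu2.symm.trans hbu)
  subst huu
  refine ⟨s, hu', ?_⟩
  convert hw' using 2
  rw [hf, sub_sub_cancel, smul_smul, inv_mul_cancel₀ hc0.ne', one_smul]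

end

/-! ### Vanishing weak gradients, cutoffs and the ground state substitution -/

noncomputable section

open Filter Topology

/-- A locally integrable function whose distributional gradient vanishes is constant. -/
theorem ae_eq_const_of_weak_gradient_eq_zero {g : E3 → ℂ} (hg : LocallyIntegrable g)
    (h : ∀ ψ : E3 → ℝ, ContDiff ℝ (⊤ : ℕ∞) ψ → HasCompactSupport ψ → ∀ j : Fin 3,
      ∫ x, fderiv ℝ ψ x (e3 j) • g x = 0) :
    ∃ c : ℂ, g =ᵐ[volume] fun _ => c := by
  -- Keeping the outer radius at most twice the inner one ensures that these mollifications converge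
  -- almost everywhere to a locally integrable function.
  let ρ : ℕ → ContDiffBump (0 : E3) := fun n =>
    ⟨1 / ((n : ℝ) + 1), 2 * (1 / ((n : ℝ) + 1)), by positivity, by
      have : 0 < 1 / ((n : ℝ) + 1) := by positivity
      linarith⟩
  have hlim := ContDiffBump.ae_convolution_tendsto_right_of_locallyIntegrable (μ := volume)
    (φ := ρ) (l := atTop) (K := 2)
    (by simpa [ρ] using tendsto_one_div_add_atTop_nhds_zero_nat (𝕜 := ℝ) |>.const_mul 2)
    (Eventually.of_forall fun n => le_rfl) hg
  -- The gradient of the mollification at y is, up to sign, the integral of g against the gradient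
  -- of t ↦ ρₙ(y - t), an admissible test function. So each mollification is constant, and the
  -- constants pass to the limit.
  have hconst : ∀ n x, (MeasureTheory.convolution ((ρ n).normed volume) g
      (ContinuousLinearMap.lsmul ℝ ℝ) volume) x = (MeasureTheory.convolution
        ((ρ n).normed volume) g (ContinuousLinearMap.lsmul ℝ ℝ) volume) 0 := by
    intro n x
    have hs : ContDiff ℝ (⊤ : ℕ∞) ((ρ n).normed (volume : Measure E3)) := (ρ n).contDiff_normed
    have hc : HasCompactSupport ((ρ n).normed (volume : Measure E3)) := (ρ n).hasCompactSupport_normed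
    have hder := hc.hasFDerivAt_convolution_left (ContinuousLinearMap.lsmul ℝ ℝ (E := ℂ))
      (hs.of_le (by simp)) hg
    refine is_const_of_fderiv_eq_zero (𝕜 := ℝ) (fun y => (hder y).differentiableAt)
      (fun y => ?_) x 0
    rw [(hder y).fderiv]
    have hz : ∀ j : Fin 3, (MeasureTheory.convolution (fderiv ℝ ((ρ n).normed (volume : Measure E3)))
        g ((ContinuousLinearMap.lsmul ℝ ℝ (E := ℂ)).precompL E3) volume y) (e3 j) = 0 := by
      intro j
      have hex : ConvolutionExistsAt (fderiv ℝ ((ρ n).normed (volume : Measure E3))) g y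
          ((ContinuousLinearMap.lsmul ℝ ℝ (E := ℂ)).precompL E3) volume :=
        (hc.fderiv ℝ).convolutionExists_left _ (hs.continuous_fderiv (by simp)) hg y
      rw [convolution_eq_swap, ContinuousLinearMap.integral_apply hex.integrable_swap]
      have h1 := h (fun t => (ρ n).normed volume (y - t))
        (hs.comp (contDiff_const.sub contDiff_id))
        (hc.comp_homeomorph (Homeomorph.subLeft y)) j
      rw [← neg_eq_zero, ← integral_neg, ← h1]
      refine integral_congr_ae (Eventually.of_forall fun t => ?_)
      have h2 : fderiv ℝ (fun t => (ρ n).normed volume (y - t)) t =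
          -(fderiv ℝ ((ρ n).normed (volume : Measure E3)) (y - t)) := by
        have h3 : HasFDerivAt ((ρ n).normed (volume : Measure E3)) _ (y - t) :=
          ((hs.differentiable (by simp)) (y - t)).hasFDerivAt
        have h4 := h3.comp t ((hasFDerivAt_id t).const_sub y)
        refine h4.fderiv.trans ?_
        ext v
        simp
      simp only [h2]
      simp
    ext v
    have hv : v = ∑ j, v j • e3 j := by
      rw [e3_eq_basisFun]
      simpa using ((EuclideanSpace.basisFun (Fin 3) ℝ).sum_repr v).symm
    rw [hv, map_sum]
    simp [hz]
  obtain ⟨x₀, hx₀⟩ := hlim.exists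
  refine ⟨g x₀, ?_⟩
  filter_upwards [hlim] with x hx
  refine tendsto_nhds_unique hx (hx₀.congr fun n => ?_)
  rw [hconst n x, hconst n x₀]

/-- The integral of a directional derivative of an integrable function vanishes. -/
theorem integral_eq_zero_of_hasLineDerivAt {f f' : E3 → ℂ} {v : E3} (hf : Integrable f)
    (hf' : Integrable f') (h : ∀ x, HasLineDerivAt ℝ f (f' x) x v) : ∫ x, f' x = 0 := by
  have := integral_bilinear_hasLineDerivAt_right_eq_neg_left_of_integrable
    (μ := (volume : Measure E3)) (f := fun _ => (1 : ℝ)) (f' := fun _ => (0 : ℝ)) (g := f)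
    (g' := f') (v := v) (B := ContinuousLinearMap.lsmul ℝ ℝ) (by simp) (by simpa using hf')
    (by simpa using hf)
    (fun x _ => by simpa [HasLineDerivAt] using hasDerivAt_const (0 : ℝ) (1 : ℝ))
    (fun x _ => h x)
  simpa using this

theorem hasLineDerivAt_schwartz {F : Type*} [NormedAddCommGroup F] [NormedSpace ℝ F]
    (s : 𝓢(E3, F)) (x v : E3) : HasLineDerivAt ℝ s ((∂_{v} s) x) x v := by
  rw [SchwartzMap.lineDerivOp_apply_eq_fderiv]
  exact (s.hasFDerivAt x).hasLineDerivAt v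

theorem im_lineDeriv_eq_zero {φ : 𝓢(E3, ℂ)} (h : ∀ x, (φ x).im = 0) (v x : E3) :
    ((∂_{v} φ : 𝓢(E3, ℂ)) x).im = 0 := by
  have h1 : HasDerivAt (fun t : ℝ => (φ (x + t • v)).im) ((∂_{v} φ : 𝓢(E3, ℂ)) x).im 0 := by
    exact (Complex.imCLM.hasFDerivAt.comp_hasDerivAt (0 : ℝ) (hasLineDerivAt_schwartz φ x v))
  have h2 : (fun t : ℝ => (φ (x + t • v)).im) = fun _ => 0 := funext fun t => h _
  rw [h2] at h1
  exact h1.unique (hasDerivAt_const _ _)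

/-- There are smooth cutoff functions which are `1` on large balls and have small gradients. -/
theorem exists_cutoff : ∃ C : ℝ, ∀ R : ℝ, 0 < R → ∃ χ : E3 → ℝ, ContDiff ℝ (⊤ : ℕ∞) χ ∧
    HasCompactSupport χ ∧ (∀ x, ‖x‖ ≤ R → χ x = 1) ∧ (∀ x, |χ x| ≤ 1) ∧
    ∀ x, ‖fderiv ℝ χ x‖ ≤ C / R := by
  let b : ContDiffBump (0 : E3) := ⟨1, 2, one_pos, one_lt_two⟩
  have hb : ContDiff ℝ (⊤ : ℕ∞) b := b.contDiff
  obtain ⟨C, hC⟩ := (b.hasCompactSupport.fderiv ℝ).exists_bound_of_continuous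
    (hb.continuous_fderiv (by simp))
  refine ⟨C, fun R hR => ⟨fun x => b (R⁻¹ • x), hb.comp (contDiff_const_smul _), ?_, ?_, ?_, ?_⟩⟩
  · exact b.hasCompactSupport.comp_homeomorph (Homeomorph.smulOfNeZero R⁻¹ (by positivity))
  · intro x hx
    refine b.one_of_mem_closedBall ?_
    rw [mem_closedBall_zero_iff, norm_smul, norm_inv, Real.norm_of_nonneg hR.le]
    exact (inv_mul_le_one₀ hR).2 hx
  · intro x
    rw [abs_of_nonneg b.nonneg]
    exact b.le_one
  · intro x
    rw [fderiv_comp_smul, norm_smul, norm_inv, Real.norm_of_nonneg hR.le, div_eq_inv_mul]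
    gcongr
    exact hC _

open ComplexConjugate

/-- `φ ∂_j (s / φ)`. -/
def groundGrad (φ s : 𝓢(E3, ℂ)) (j : Fin 3) (x : E3) : ℂ :=
  (∂_{e3 j} s : 𝓢(E3, ℂ)) x - s x * (∂_{e3 j} φ : 𝓢(E3, ℂ)) x * (φ x)⁻¹

theorem continuous_inv_schwartz {φ : 𝓢(E3, ℂ)} (h0 : ∀ x, φ x ≠ 0) :
    Continuous fun x => (φ x)⁻¹ :=
  φ.continuous.inv₀ h0

theorem continuous_groundGrad {φ : 𝓢(E3, ℂ)} (h0 : ∀ x, φ x ≠ 0) (s : 𝓢(E3, ℂ)) (j : Fin 3) :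
    Continuous (groundGrad φ s j) :=
  (SchwartzMap.continuous _).sub
    ((s.continuous.mul (SchwartzMap.continuous _)).mul (continuous_inv_schwartz h0))

theorem hasLineDerivAt_div {φ : 𝓢(E3, ℂ)} (h0 : ∀ x, φ x ≠ 0) (s : 𝓢(E3, ℂ)) (j : Fin 3)
    (x : E3) :
    HasLineDerivAt ℝ (fun x => s x * (φ x)⁻¹) (groundGrad φ s j x * (φ x)⁻¹) x (e3 j) := by
  have h1 := hasLineDerivAt_schwartz s x (e3 j)
  have h2 := hasLineDerivAt_schwartz φ x (e3 j)
  unfold HasLineDerivAt at *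
  have h3 := h1.mul (h2.fun_inv (by simpa using h0 x))
  refine HasDerivAt.congr_deriv h3 ?_
  simp only [zero_smul, add_zero, groundGrad]
  have := h0 x
  field_simp
  ring

/-- The divergence identity behind the substitution: with X = φ∇(s/φ), the derivative of X_j
contributes -(∂_jφ/φ)X_j, which combines with ∂_j s̄ to give X̄_j because φ is real. Summed over j,
the last term carries Δs - sΔφ/φ, that is -L₋s when φ solves the equation. -/
theorem hasLineDerivAt_groundFlux {φ : 𝓢(E3, ℂ)} (hre : ∀ x, (φ x).im = 0) (h0 : ∀ x, φ x ≠ 0)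
    (s : 𝓢(E3, ℂ)) {χ : E3 → ℝ} (hχ : ContDiff ℝ (⊤ : ℕ∞) χ) (j : Fin 3) (x : E3) :
    HasLineDerivAt ℝ (fun x => (χ x : ℂ) ^ 2 * conj (s x) * groundGrad φ s j x)
      (2 * (χ x : ℂ) * (fderiv ℝ χ x (e3 j) : ℝ) * conj (s x) * groundGrad φ s j x +
        (χ x : ℂ) ^ 2 * (conj (groundGrad φ s j x) * groundGrad φ s j x) +
        (χ x : ℂ) ^ 2 * conj (s x) * ((∂_{e3 j} (∂_{e3 j} s) : 𝓢(E3, ℂ)) x -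
          s x * (∂_{e3 j} (∂_{e3 j} φ) : 𝓢(E3, ℂ)) x * (φ x)⁻¹)) x (e3 j) := by
  have h1 := hasLineDerivAt_schwartz s x (e3 j)
  have h2 := hasLineDerivAt_schwartz φ x (e3 j)
  have h3 := hasLineDerivAt_schwartz (∂_{e3 j} s) x (e3 j)
  have h4 := hasLineDerivAt_schwartz (∂_{e3 j} φ) x (e3 j)
  have h5 : HasLineDerivAt ℝ χ (fderiv ℝ χ x (e3 j)) x (e3 j) :=
    ((hχ.differentiable (by simp)) x).hasFDerivAt.hasLineDerivAt _
  have c1 : conj (φ x) = φ x := Complex.conj_eq_iff_im.2 (hre x)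
  have c2 : conj ((∂_{e3 j} φ : 𝓢(E3, ℂ)) x) = (∂_{e3 j} φ : 𝓢(E3, ℂ)) x :=
    Complex.conj_eq_iff_im.2 (im_lineDeriv_eq_zero hre _ x)
  unfold HasLineDerivAt at *
  have h6 := ((h5.ofReal_comp.pow 2).mul h1.star).mul
    (h3.sub ((h1.mul h4).mul (h2.fun_inv (by simpa using h0 x))))
  refine HasDerivAt.congr_deriv h6 ?_
  simp only [zero_smul, add_zero, groundGrad, map_sub, map_mul, map_inv₀, c1, c2, Pi.mul_apply,
    Pi.sub_apply, Pi.pow_apply, ← starRingEnd_apply]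
  have := h0 x
  field_simp
  push_cast
  ring

end

/-! ### Energy estimate for φ∇(s/φ) and the kernel of L₋ -/

noncomputable section

open Filter Topology ComplexConjugate

theorem integral_norm_mul_norm_le (f g : L2 ℂ) : ∫ x, ‖f x‖ * ‖g x‖ ≤ ‖f‖ * ‖g‖ := by
  have hf := (Lp.memLp f).norm
  have hg := (Lp.memLp g).norm
  have h := real_inner_le_norm (hf.toLp _) (hg.toLp _)
  rw [L2.inner_def, Lp.norm_toLp, Lp.norm_toLp, eLpNorm_norm, eLpNorm_norm] at h
  refine le_of_eq_of_le (integral_congr_ae ?_) h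
  filter_upwards [hf.coeFn_toLp, hg.coeFn_toLp] with x h1 h2
  rw [h1, h2]
  simp [mul_comm]

theorem integrable_norm_mul_norm (f g : L2 ℂ) : Integrable fun x => ‖f x‖ * ‖g x‖ :=
  (Lp.memLp f).norm.integrable_mul (Lp.memLp g).norm

theorem integral_norm_sq_eq (f : L2 ℂ) : ∫ x, ‖f x‖ ^ 2 = ‖f‖ ^ 2 := by
  rw [← real_inner_self_eq_norm_sq, L2.inner_def]
  simp

theorem integral_norm_sq_schwartz (s : 𝓢(E3, ℂ)) : ∫ x, ‖s x‖ ^ 2 = ‖toL2 s‖ ^ 2 := by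
  rw [← integral_norm_sq_eq]
  refine integral_congr_ae ?_
  filter_upwards [s.coeFn_toLp 2] with x hx
  rw [hx]

theorem integrable_norm_sq_schwartz (s : 𝓢(E3, ℂ)) : Integrable fun x => ‖s x‖ ^ 2 :=
  (s.memLp 2).integrable_norm_pow (by norm_num)

theorem norm_fderiv_e3_le (χ : E3 → ℝ) (j : Fin 3) (x : E3) :
    |fderiv ℝ χ x (e3 j)| ≤ ‖fderiv ℝ χ x‖ := by
  have := (fderiv ℝ χ x).le_opNorm (e3 j)
  simpa [e3] using this

section Ground

variable {φ : 𝓢(E3, ℂ)}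

/-- The localized energy estimate for the ground state substitution `s = φ g`. -/
theorem integral_cutoff_groundGrad_le (hre : ∀ x, (φ x).im = 0) (h0 : ∀ x, φ x ≠ 0)
    (s : 𝓢(E3, ℂ)) {χ : E3 → ℝ} (hχ : ContDiff ℝ (⊤ : ℕ∞) χ) (hc : HasCompactSupport χ) :
    ∫ x, χ x ^ 2 * ∑ j, ‖groundGrad φ s j x‖ ^ 2 ≤
      4 * (∫ x, (∑ j, fderiv ℝ χ x (e3 j) ^ 2) * ‖s x‖ ^ 2) +
      2 * ∫ x, χ x ^ 2 * (‖s x‖ * ‖(Δ s) x - s x * (Δ φ) x * (φ x)⁻¹‖) := by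
  have hφi := continuous_inv_schwartz h0
  have hX := continuous_groundGrad h0 s
  have hχc := hχ.continuous
  have hχ' : Continuous (fderiv ℝ χ) := hχ.continuous_fderiv (by simp)
  have hsc := s.continuous
  have hcs : Continuous fun x => conj (s x) := Complex.continuous_conj.comp hsc
  have hL : ∀ f : 𝓢(E3, ℂ), Continuous f := fun f => f.continuous
  set G : Fin 3 → E3 → ℂ := fun j x =>
    2 * (χ x : ℂ) * (fderiv ℝ χ x (e3 j) : ℝ) * conj (s x) * groundGrad φ s j x +
        (χ x : ℂ) ^ 2 * (conj (groundGrad φ s j x) * groundGrad φ s j x) +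
        (χ x : ℂ) ^ 2 * conj (s x) * ((∂_{e3 j} (∂_{e3 j} s) : 𝓢(E3, ℂ)) x -
          s x * (∂_{e3 j} (∂_{e3 j} φ) : 𝓢(E3, ℂ)) x * (φ x)⁻¹) with hG
  have hzero : ∀ x, x ∉ tsupport χ → χ x = 0 := fun x hx => image_eq_zero_of_notMem_tsupport hx
  have hGi : ∀ j, Integrable (G j) := fun j => by
    refine Continuous.integrable_of_hasCompactSupport ?_ ?_
    · have h1 := hX j
      have h2 : Continuous fun x => fderiv ℝ χ x (e3 j) := hχ'.clm_apply continuous_const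
      have h3 : Continuous fun x => conj (groundGrad φ s j x) := Complex.continuous_conj.comp h1
      have h4 := hL (∂_{e3 j} (∂_{e3 j} s))
      have h5 := hL (∂_{e3 j} (∂_{e3 j} φ))
      simp only [hG]
      fun_prop
    · refine HasCompactSupport.intro hc fun x hx => ?_
      simp [hG, hzero x hx]
  have hFi : ∀ j, Integrable fun x => (χ x : ℂ) ^ 2 * conj (s x) * groundGrad φ s j x := fun j => by
    refine Continuous.integrable_of_hasCompactSupport ?_ ?_
    · have h1 := hX j
      fun_prop
    · refine HasCompactSupport.intro hc fun x hx => ?_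
      simp [hzero x hx]
  -- Each G j is a directional derivative of a compactly supported flux.
  have hint_zero : ∀ j, ∫ x, (G j x).re = 0 := fun j => by
    have h1 := integral_eq_zero_of_hasLineDerivAt (hFi j) (hGi j)
      (fun x => hasLineDerivAt_groundFlux hre h0 s hχ j x)
    have h2 := integral_re (hGi j)
    rw [h1] at h2
    simpa using h2
  have hGr : ∀ j, Integrable fun x => (G j x).re := fun j => (hGi j).re
  have hsum : ∫ x, ∑ j, (G j x).re = 0 := by
    rw [integral_finsetSum _ fun j _ => hGr j]
    exact Finset.sum_eq_zero fun j _ => hint_zero j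
  have hi1 : Integrable fun x => χ x ^ 2 * ∑ j, ‖groundGrad φ s j x‖ ^ 2 := by
    refine Continuous.integrable_of_hasCompactSupport ?_ ?_
    · fun_prop
    · refine HasCompactSupport.intro hc fun x hx => ?_
      simp [hzero x hx]
  have hi2 : Integrable fun x => (∑ j, fderiv ℝ χ x (e3 j) ^ 2) * ‖s x‖ ^ 2 := by
    refine Continuous.integrable_of_hasCompactSupport ?_ ?_
    · have h2 : ∀ j, Continuous fun x => fderiv ℝ χ x (e3 j) :=
        fun j => hχ'.clm_apply continuous_const
      fun_prop
    · refine HasCompactSupport.intro (hc.fderiv ℝ) fun x hx => ?_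
      simp [image_eq_zero_of_notMem_tsupport hx]
  have hi3 : Integrable fun x =>
      χ x ^ 2 * (‖s x‖ * ‖(Δ s) x - s x * (Δ φ) x * (φ x)⁻¹‖) := by
    refine Continuous.integrable_of_hasCompactSupport ?_ ?_
    · have h4 := hL (Δ s)
      have h5 := hL (Δ φ)
      fun_prop
    · refine HasCompactSupport.intro hc fun x hx => ?_
      simp [hzero x hx]
  have hpt : ∀ x, χ x ^ 2 * ∑ j, ‖groundGrad φ s j x‖ ^ 2 ≤
      4 * ((∑ j, fderiv ℝ χ x (e3 j) ^ 2) * ‖s x‖ ^ 2) +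
      2 * (χ x ^ 2 * (‖s x‖ * ‖(Δ s) x - s x * (Δ φ) x * (φ x)⁻¹‖)) + 2 * ∑ j, (G j x).re := by
    intro x
    set d : Fin 3 → ℂ := fun j => (∂_{e3 j} (∂_{e3 j} s) : 𝓢(E3, ℂ)) x -
      s x * (∂_{e3 j} (∂_{e3 j} φ) : 𝓢(E3, ℂ)) x * (φ x)⁻¹ with hd
    have hdsum : ∑ j, d j = (Δ s) x - s x * (Δ φ) x * (φ x)⁻¹ := by
      rw [laplacian_eq_sum_e3, laplacian_eq_sum_e3, sum_apply, sum_apply, Finset.mul_sum,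
        Finset.sum_mul, ← Finset.sum_sub_distrib]
    have hGre : ∀ j, (G j x).re = 2 * χ x * fderiv ℝ χ x (e3 j) *
        (conj (s x) * groundGrad φ s j x).re + χ x ^ 2 * ‖groundGrad φ s j x‖ ^ 2 +
        χ x ^ 2 * (conj (s x) * d j).re := by
      intro j
      have e : G j x = ((2 * χ x * fderiv ℝ χ x (e3 j) : ℝ) : ℂ) *
          (conj (s x) * groundGrad φ s j x) + ((χ x ^ 2 * ‖groundGrad φ s j x‖ ^ 2 : ℝ) : ℂ) +
          ((χ x ^ 2 : ℝ) : ℂ) * (conj (s x) * d j) := by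
        simp only [hG, Complex.conj_mul', hd]
        push_cast
        ring
      rw [e, Complex.add_re, Complex.add_re, Complex.re_ofReal_mul, Complex.re_ofReal_mul,
        Complex.ofReal_re]
    -- Young's inequality: the cross term costs half of χ²|X_j|², which is absorbed on the left.
    -- Multiplying through by 2 produces the constants 4 and 2.
    have hb : ∀ j, -(2 * χ x * fderiv ℝ χ x (e3 j) * (conj (s x) * groundGrad φ s j x).re) ≤
        χ x ^ 2 * ‖groundGrad φ s j x‖ ^ 2 / 2 + 2 * (fderiv ℝ χ x (e3 j) ^ 2 * ‖s x‖ ^ 2) := by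
      intro j
      have h1 : |(conj (s x) * groundGrad φ s j x).re| ≤ ‖s x‖ * ‖groundGrad φ s j x‖ := by
        refine (Complex.abs_re_le_norm _).trans_eq ?_
        rw [norm_mul, RCLike.norm_conj]
      refine (neg_le_abs _).trans ?_
      rw [abs_mul, abs_mul, abs_mul, abs_two, ← sq_abs (χ x), ← sq_abs (fderiv ℝ χ x (e3 j))]
      have h2 : 2 * |χ x| * |fderiv ℝ χ x (e3 j)| * |(conj (s x) * groundGrad φ s j x).re| ≤
          2 * |χ x| * |fderiv ℝ χ x (e3 j)| * (‖s x‖ * ‖groundGrad φ s j x‖) := by gcongr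
      nlinarith [sq_nonneg (|χ x| * ‖groundGrad φ s j x‖ -
        2 * (|fderiv ℝ χ x (e3 j)| * ‖s x‖))]
    have hdre : -(conj (s x) * ∑ j, d j).re ≤ ‖s x‖ * ‖∑ j, d j‖ := by
      refine (neg_le_abs _).trans ((Complex.abs_re_le_norm _).trans_eq ?_)
      rw [norm_mul, RCLike.norm_conj]
    have hdd : (conj (s x) * ∑ j, d j).re = ∑ j, (conj (s x) * d j).re := by
      rw [Finset.mul_sum, Complex.re_sum]
    rw [← hdsum]
    have hd2 := mul_le_mul_of_nonneg_left hdre (sq_nonneg (χ x))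
    rw [hdd] at hd2
    simp only [hGre, Fin.sum_univ_three] at hd2 ⊢
    have b0 := hb 0
    have b1 := hb 1
    have b2 := hb 2
    linarith
  have hmono := integral_mono hi1 (((hi2.const_mul 4).add (hi3.const_mul 2)).add
    ((integrable_finsetSum _ fun j _ => hGr j).const_mul 2)) hpt
  refine hmono.trans_eq ?_
  rw [integral_add' ((hi2.const_mul 4).add (hi3.const_mul 2))
    ((integrable_finsetSum _ fun j _ => hGr j).const_mul 2),
    integral_add' (hi2.const_mul 4) (hi3.const_mul 2), integral_const_mul, integral_const_mul,
    integral_const_mul, hsum, mul_zero, add_zero]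

/-- If `V = Δφ / φ` and `w = V u`, then `φ ∇(s / φ)` is controlled by the distance of `(s, Δs)`
to `(u, w)`. -/
theorem integral_ball_groundGrad_le (hre : ∀ x, (φ x).im = 0) (h0 : ∀ x, φ x ≠ 0)
    {V : E3 → ℝ} {K : ℝ} (hV : ∀ x, (Δ φ) x = V x * φ x) (hK : ∀ x, |V x| ≤ K)
    {u w : L2 ℂ} (hw : ∀ᵐ x, w x = V x * u x) (s : 𝓢(E3, ℂ)) {R : ℝ} (hR : 0 < R) :
    ∫ x in Metric.closedBall (0 : E3) R, ∑ j, ‖groundGrad φ s j x‖ ^ 2 ≤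
      2 * (‖toL2 s‖ * (‖toL2 (Δ s) - w‖ + K * ‖toL2 s - u‖)) := by
  obtain ⟨C, hC⟩ := exists_cutoff
  have hX := continuous_groundGrad h0 s
  have hXc : Continuous fun x => ∑ j, ‖groundGrad φ s j x‖ ^ 2 := by fun_prop
  set B := ‖toL2 s‖ * (‖toL2 (Δ s) - w‖ + K * ‖toL2 s - u‖)
  -- The cutoff lives at a scale r ≥ R independent of the ball. Its gradient term is at most 4 ·
  -- 3(C/r)²‖s‖² and disappears as r → ∞.
  have hmain : ∀ r : ℝ, R ≤ r → ∫ x in Metric.closedBall (0 : E3) R,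
      ∑ j, ‖groundGrad φ s j x‖ ^ 2 ≤ 12 * (C / r) ^ 2 * ‖toL2 s‖ ^ 2 + 2 * B := by
    intro r hr
    have hr0 : 0 < r := hR.trans_le hr
    obtain ⟨χ, hχ, hc, h1, hle, hgrad⟩ := hC r hr0
    have hχc := hχ.continuous
    have hi1 : Integrable fun x => χ x ^ 2 * ∑ j, ‖groundGrad φ s j x‖ ^ 2 := by
      refine Continuous.integrable_of_hasCompactSupport (by fun_prop) ?_
      refine HasCompactSupport.intro hc fun x hx => ?_
      simp [image_eq_zero_of_notMem_tsupport hx]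
    have e1 : ∫ x in Metric.closedBall (0 : E3) R, ∑ j, ‖groundGrad φ s j x‖ ^ 2 ≤
        ∫ x, χ x ^ 2 * ∑ j, ‖groundGrad φ s j x‖ ^ 2 := by
      refine le_of_eq_of_le (setIntegral_congr_fun measurableSet_closedBall fun x hx => ?_)
        (setIntegral_le_integral hi1 (Eventually.of_forall fun x => ?_))
      · rw [h1 x ((mem_closedBall_zero_iff.1 hx).trans hr)]
        ring
      · simp only [Pi.zero_apply]
        positivity
    refine e1.trans ((integral_cutoff_groundGrad_le hre h0 s hχ hc).trans ?_)
    have e2 : ∫ x, (∑ j, fderiv ℝ χ x (e3 j) ^ 2) * ‖s x‖ ^ 2 ≤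
        3 * (C / r) ^ 2 * ‖toL2 s‖ ^ 2 := by
      rw [← integral_norm_sq_schwartz, ← integral_const_mul]
      refine integral_mono_of_nonneg (Eventually.of_forall fun x => ?_)
        ((integrable_norm_sq_schwartz s).const_mul _) (Eventually.of_forall fun x => ?_)
      · simp only [Pi.zero_apply]
        positivity
      · have hj : ∀ j, fderiv ℝ χ x (e3 j) ^ 2 ≤ (C / r) ^ 2 := fun j => by
          rw [← sq_abs]
          exact pow_le_pow_left₀ (abs_nonneg _) ((norm_fderiv_e3_le χ j x).trans (hgrad x)) 2
        refine mul_le_mul_of_nonneg_right ?_ (by positivity)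
        rw [Fin.sum_univ_three]
        linarith [hj 0, hj 1, hj 2]
    have est3 : ∫ x, χ x ^ 2 * (‖s x‖ * ‖(Δ s) x - s x * (Δ φ) x * (φ x)⁻¹‖) ≤ B := by
      have hd := integrable_norm_mul_norm (toL2 s) (toL2 (Δ s) - w)
      have hd' := integrable_norm_mul_norm (toL2 s) (toL2 s - u)
      have hb : ∫ x, (‖toL2 s x‖ * ‖(toL2 (Δ s) - w) x‖ +
          K * (‖toL2 s x‖ * ‖(toL2 s - u) x‖)) ≤ B := by
        rw [integral_add hd (hd'.const_mul K), integral_const_mul]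
        have hK0 : 0 ≤ K := (abs_nonneg _).trans (hK 0)
        have := mul_le_mul_of_nonneg_left (integral_norm_mul_norm_le (toL2 s) (toL2 s - u)) hK0
        have h2 := integral_norm_mul_norm_le (toL2 s) (toL2 (Δ s) - w)
        simp only [B]
        linarith
      refine le_trans (integral_mono_of_nonneg (Eventually.of_forall fun x => ?_)
        (hd.add (hd'.const_mul K)) ?_) hb
      · simp only [Pi.zero_apply]
        positivity
      · filter_upwards [s.coeFn_toLp 2, (Δ s).coeFn_toLp 2, Lp.coeFn_sub (toL2 (Δ s)) w,
          Lp.coeFn_sub (toL2 s) u, hw] with x a1 a2 a3 a4 a5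
        simp only [Pi.add_apply, a3, a4, Pi.sub_apply, a1, a2, a5]
        have hχ1 : χ x ^ 2 ≤ 1 := by
          rw [← sq_abs]
          exact pow_le_one₀ (abs_nonneg _) (hle x)
        -- As Δφ/φ = V and w = Vu, the residual Δs - Vs measures only the distance of (s, Δs) from
        -- (u, w).
        have e : (Δ s) x - s x * (Δ φ) x * (φ x)⁻¹ =
            ((Δ s) x - V x * u x) - V x * (s x - u x) := by
          rw [hV x]
          have := h0 x
          field_simp
          ring
        calc χ x ^ 2 * (‖s x‖ * ‖(Δ s) x - s x * (Δ φ) x * (φ x)⁻¹‖)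
            ≤ 1 * (‖s x‖ * ‖(Δ s) x - s x * (Δ φ) x * (φ x)⁻¹‖) := by gcongr
          _ ≤ ‖s x‖ * (‖(Δ s) x - V x * u x‖ + K * ‖s x - u x‖) := by
              rw [one_mul, e]
              gcongr
              refine (norm_sub_le _ _).trans ?_
              rw [norm_mul, Complex.norm_real, Real.norm_eq_abs]
              gcongr
              exact hK x
          _ = _ := by ring
    linarith
  have hlim : Tendsto (fun r : ℝ => 12 * (C / r) ^ 2 * ‖toL2 s‖ ^ 2 + 2 * B) atTop
      (𝓝 (12 * 0 ^ 2 * ‖toL2 s‖ ^ 2 + 2 * B)) :=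
    (((tendsto_const_nhds.div_atTop tendsto_id).pow 2).const_mul 12 |>.mul_const _).add_const _
  simp only [ne_eq, OfNat.ofNat_ne_zero, not_false_eq_true, zero_pow, mul_zero, zero_mul,
    zero_add] at hlim
  exact ge_of_tendsto hlim ((eventually_ge_atTop R).mono hmain)

/-- The kernel of `-Δ + V` is spanned by a positive solution `φ`. -/
theorem eq_smul_of_isLaplacian (hre : ∀ x, (φ x).im = 0) (h0 : ∀ x, φ x ≠ 0)
    {V : E3 → ℝ} {K : ℝ} (hV : ∀ x, (Δ φ) x = V x * φ x) (hK : ∀ x, |V x| ≤ K)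
    {u w : L2 ℂ} (huw : IsLaplacian u w) (hw : ∀ᵐ x, w x = V x * u x) :
    ∃ c : ℂ, u = c • toL2 φ := by
  have hφi := continuous_inv_schwartz h0
  have hφs : ContDiff ℝ (⊤ : ℕ∞) fun x => (φ x)⁻¹ := (φ.smooth ⊤).inv h0
  have hg : LocallyIntegrable (fun x => u x * (φ x)⁻¹) volume := by
    have h1 : LocallyIntegrable u volume := (Lp.memLp u).locallyIntegrable (by norm_num)
    rw [← locallyIntegrableOn_univ] at h1 ⊢
    exact h1.mul_continuousOn hφi.continuousOn isClosed_univ.isLocallyClosed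
  obtain ⟨s, hsu, hsw⟩ := huw.exists_schwartz_tendsto
  -- It suffices that u/φ has zero weak gradient. For the approximants, ∫ ∂_jψ s/φ = -∫
  -- (ψ/φ)·φ∂_j(s/φ), and φ∇(s/φ) tends to 0 in L² on the support of ψ.
  obtain ⟨c, hc⟩ := ae_eq_const_of_weak_gradient_eq_zero hg (by
    intro ψ hψ hcψ j
    have hψ' : Continuous (fderiv ℝ ψ) := hψ.continuous_fderiv (by simp)
    have hψj : Continuous fun x => fderiv ℝ ψ x (e3 j) := hψ'.clm_apply continuous_const
    have hz : ∀ x, x ∉ tsupport ψ → ψ x = 0 := fun x hx => image_eq_zero_of_notMem_tsupport hx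
    have hz' : ∀ x, x ∉ tsupport ψ → fderiv ℝ ψ x = 0 := fun x hx =>
      image_eq_zero_of_notMem_tsupport fun h => hx (tsupport_fderiv_subset ℝ h)
    -- the test function `∂_jψ / φ`
    have hκc : HasCompactSupport fun x => ((fderiv ℝ ψ x (e3 j) : ℝ) : ℂ) * (φ x)⁻¹ :=
      HasCompactSupport.intro hcψ fun x hx => by simp [hz' x hx]
    have hκs : ContDiff ℝ (⊤ : ℕ∞) fun x => ((fderiv ℝ ψ x (e3 j) : ℝ) : ℂ) * (φ x)⁻¹ := by
      refine ContDiff.mul (Complex.ofRealCLM.contDiff.comp ?_) hφs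
      exact (hψ.fderiv_right (m := (⊤ : ℕ∞)) (by simp)).clm_apply contDiff_const
    set κ : 𝓢(E3, ℂ) := hκc.toSchwartzMap hκs with hκ
    have hκx : ∀ x, κ x = ((fderiv ℝ ψ x (e3 j) : ℝ) : ℂ) * (φ x)⁻¹ := fun x => rfl
    have hlim : Tendsto (fun n => ∫ x, κ x * s n x) atTop (𝓝 (∫ x, κ x * u x)) := by
      have h1 : Continuous fun f : L2 ℂ => (f : 𝓢'(E3, ℂ)) κ :=
        (PointwiseConvergenceCLM.evalCLM (RingHom.id ℂ) ℂ κ).continuous.comp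
          (Lp.toTemperedDistributionCLM ℂ (volume : Measure E3) 2).continuous
      have h2 := (h1.tendsto u).comp hsu
      simp only [Lp.toTemperedDistribution_apply, smul_eq_mul] at h2
      refine h2.congr fun n => integral_congr_ae ?_
      filter_upwards [(s n).coeFn_toLp 2] with x hx
      rw [hx]
    have hgoal : ∫ x, fderiv ℝ ψ x (e3 j) • (u x * (φ x)⁻¹) = ∫ x, κ x * u x := by
      refine integral_congr_ae (Eventually.of_forall fun x => ?_)
      simp only [hκx, Complex.real_smul]
      ring
    rw [hgoal]
    -- integration by parts
    set a : E3 → ℂ := fun x => (ψ x : ℂ) * (φ x)⁻¹ with ha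
    have hac : Continuous a := by
      have := hψ.continuous
      fun_prop
    have hacs : HasCompactSupport a := HasCompactSupport.intro hcψ fun x hx => by
      simp [ha, hz x hx]
    have hparts : ∀ n, ∫ x, κ x * s n x = -∫ x, a x * groundGrad φ (s n) j x := by
      intro n
      have hXc := continuous_groundGrad h0 (s n) j
      have hsc := (s n).continuous
      have hi1 : Integrable fun x => κ x * s n x :=
        (κ.continuous.mul hsc).integrable_of_hasCompactSupport hκc.mul_right
      have hi2 : Integrable fun x => a x * groundGrad φ (s n) j x :=
        (hac.mul hXc).integrable_of_hasCompactSupport hacs.mul_right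
      have hi3 : Integrable fun x => a x * s n x :=
        (hac.mul hsc).integrable_of_hasCompactSupport hacs.mul_right
      have h := integral_eq_zero_of_hasLineDerivAt (v := e3 j) hi3 (hi1.add hi2) (by
        intro x
        have h1 : HasLineDerivAt ℝ ψ (fderiv ℝ ψ x (e3 j)) x (e3 j) :=
          ((hψ.differentiable (by simp)) x).hasFDerivAt.hasLineDerivAt _
        have h2 := hasLineDerivAt_div h0 (s n) j x
        unfold HasLineDerivAt at *
        have h3 := h1.ofReal_comp.mul h2
        have e : (fun t : ℝ => a (x + t • e3 j) * s n (x + t • e3 j)) =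
            (fun t : ℝ => ((ψ (x + t • e3 j) : ℝ) : ℂ)) *
              fun t : ℝ => s n (x + t • e3 j) * (φ (x + t • e3 j))⁻¹ := by
          ext t
          simp only [ha, Pi.mul_apply]
          ring
        rw [e]
        refine h3.congr_deriv ?_
        simp only [hκx, ha, zero_smul, add_zero, Pi.add_apply]
        ring)
      rw [integral_add' hi1 hi2] at h
      exact eq_neg_of_add_eq_zero_left h
    obtain ⟨R, hR0, hR⟩ := hcψ.isCompact.isBounded.subset_closedBall_lt 0 (0 : E3)
    set D : ℕ → ℝ := fun n =>
      2 * (‖toL2 (s n)‖ * (‖toL2 (Δ (s n)) - w‖ + K * ‖toL2 (s n) - u‖)) with hD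
    have hD0 : Tendsto D atTop (𝓝 0) := by
      have h1 : Tendsto (fun n => ‖toL2 (Δ (s n)) - w‖) atTop (𝓝 0) := by
        simpa using (hsw.sub_const w).norm
      have h2 : Tendsto (fun n => ‖toL2 (s n) - u‖) atTop (𝓝 0) := by
        simpa using (hsu.sub_const u).norm
      simpa using (hsu.norm.mul (h1.add (h2.const_mul K))).const_mul 2
    have hA : Integrable fun x => ‖a x‖ ^ 2 := by
      refine Continuous.integrable_of_hasCompactSupport (by fun_prop) ?_
      refine HasCompactSupport.intro hacs fun x hx => ?_
      simp [image_eq_zero_of_notMem_tsupport hx]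
    -- Weighted Young inequality in place of Cauchy–Schwarz: n → ∞ at fixed ε removes D n, and then
    -- ε → 0 removes the other term.
    have hbound : ∀ ε : ℝ, 0 < ε → ∀ n, 2 * ‖∫ x, κ x * s n x‖ ≤
        ε⁻¹ * D n + ε * ∫ x, ‖a x‖ ^ 2 := by
      intro ε hε n
      have hX : ∀ j, Continuous (groundGrad φ (s n) j) := continuous_groundGrad h0 (s n)
      have hXi : IntegrableOn (fun x => ∑ j, ‖groundGrad φ (s n) j x‖ ^ 2)
          (Metric.closedBall (0 : E3) R) :=
        (show Continuous fun x => ∑ j, ‖groundGrad φ (s n) j x‖ ^ 2 by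
          fun_prop).continuousOn.integrableOn_compact (isCompact_closedBall _ _)
      have hXi' := hXi.integrable_indicator measurableSet_closedBall
      rw [hparts n, norm_neg]
      have hB := integral_ball_groundGrad_le hre h0 hV hK hw (s n) hR0
      rw [← integral_indicator measurableSet_closedBall] at hB
      calc 2 * ‖∫ x, a x * groundGrad φ (s n) j x‖
          ≤ 2 * ∫ x, ‖a x * groundGrad φ (s n) j x‖ := by
            gcongr
            exact norm_integral_le_integral_norm _
        _ = ∫ x, 2 * ‖a x * groundGrad φ (s n) j x‖ := (integral_const_mul _ _).symm
        _ ≤ ∫ x, (ε⁻¹ * (Metric.closedBall (0 : E3) R).indicator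
              (fun x => ∑ j, ‖groundGrad φ (s n) j x‖ ^ 2) x + ε * ‖a x‖ ^ 2) := by
            refine integral_mono_of_nonneg (Eventually.of_forall fun x => by positivity)
              ((hXi'.const_mul _).add (hA.const_mul _)) (Eventually.of_forall fun x => ?_)
            simp only
            by_cases hx : x ∈ Metric.closedBall (0 : E3) R
            · rw [indicator_of_mem hx, norm_mul]
              have h1 : ‖groundGrad φ (s n) j x‖ ^ 2 ≤ ∑ j, ‖groundGrad φ (s n) j x‖ ^ 2 :=
                Finset.single_le_sum (f := fun j => ‖groundGrad φ (s n) j x‖ ^ 2)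
                  (fun _ _ => by positivity) (Finset.mem_univ j)
              have h2 : 2 * (‖a x‖ * ‖groundGrad φ (s n) j x‖) ≤
                  ε⁻¹ * ‖groundGrad φ (s n) j x‖ ^ 2 + ε * ‖a x‖ ^ 2 := by
                have h3 : 0 ≤ ε⁻¹ * (‖groundGrad φ (s n) j x‖ - ε * ‖a x‖) ^ 2 := by positivity
                have h4 : ε⁻¹ * (‖groundGrad φ (s n) j x‖ - ε * ‖a x‖) ^ 2 =
                    ε⁻¹ * ‖groundGrad φ (s n) j x‖ ^ 2 + ε * ‖a x‖ ^ 2 -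
                      2 * (‖a x‖ * ‖groundGrad φ (s n) j x‖) := by
                  field_simp
                  ring
                linarith
              refine h2.trans ?_
              gcongr
            · have : ψ x = 0 := hz x fun h => hx (hR h)
              rw [indicator_of_notMem hx]
              simp [ha, this]
        _ = ε⁻¹ * (∫ x, (Metric.closedBall (0 : E3) R).indicator
              (fun x => ∑ j, ‖groundGrad φ (s n) j x‖ ^ 2) x) + ε * ∫ x, ‖a x‖ ^ 2 := by
            rw [integral_add (hXi'.const_mul _) (hA.const_mul _), integral_const_mul,
              integral_const_mul]
        _ ≤ ε⁻¹ * D n + ε * ∫ x, ‖a x‖ ^ 2 := by gcongr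
    have hfin : ∀ ε : ℝ, 0 < ε → 2 * ‖∫ x, κ x * u x‖ ≤ ε * ∫ x, ‖a x‖ ^ 2 := by
      intro ε hε
      have h1 := (hD0.const_mul ε⁻¹).add_const (ε * ∫ x, ‖a x‖ ^ 2)
      rw [mul_zero, zero_add] at h1
      exact le_of_tendsto_of_tendsto' (hlim.norm.const_mul 2) h1 (hbound ε hε)
    have h2 : 2 * ‖∫ x, κ x * u x‖ ≤ 0 := by
      have h3 : Tendsto (fun ε : ℝ => ε * ∫ x, ‖a x‖ ^ 2) (𝓝[>] 0) (𝓝 0) := by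
        have : Tendsto (fun ε : ℝ => ε * ∫ x, ‖a x‖ ^ 2) (𝓝 0) (𝓝 (0 * ∫ x, ‖a x‖ ^ 2)) :=
          tendsto_id.mul_const _
        rw [zero_mul] at this
        exact this.mono_left nhdsWithin_le_nhds
      exact ge_of_tendsto h3 (eventually_mem_nhdsWithin.mono hfin)
    exact norm_le_zero_iff.1 (by linarith))
  refine ⟨c, Lp.ext ?_⟩
  filter_upwards [hc, Lp.coeFn_smul c (toL2 φ), φ.coeFn_toLp 2] with x h1 h2 h3
  rw [h2, Pi.smul_apply, h3, smul_eq_mul, ← h1, mul_assoc, inv_mul_cancel₀ (h0 x), mul_one]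

end Ground

end

/-! ### Calculus of Schwartz functions and the graphs of Schrödinger operators -/

noncomputable section

open Filter Topology ComplexConjugate

/-- Continuous linear maps preserve derivatives of curves in topological vector spaces. -/
theorem hasDerivAt_clm_comp {X Y : Type*} [AddCommGroup X] [Module ℝ X] [TopologicalSpace X]
    [ContinuousSMul ℝ X] [AddCommGroup Y] [Module ℝ Y] [TopologicalSpace Y] [ContinuousSMul ℝ Y]
    (L : X →L[ℝ] Y) {f : ℝ → X} {f' : X} {t : ℝ} (h : HasDerivAt f f' t) :
    HasDerivAt (fun s => L (f s)) (L f') t := by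
  have h1 := HasFDerivAtFilter.isLittleOTVS h
  refine HasFDerivAtFilter.of_isLittleOTVS ?_
  refine ((ContinuousLinearMap.isBigOTVS_comp (g := L)).trans_isLittleOTVS h1).congr_left fun p => ?_
  simp

section Schwartz

variable {F G : Type*} [NormedAddCommGroup F] [NormedSpace ℝ F] [NormedAddCommGroup G]
  [NormedSpace ℝ G]

theorem lineDeriv_postcomp (L : F →L[ℝ] G) (f : 𝓢(E3, F)) (v : E3) :
    (∂_{v} (f.postcompCLM L) : 𝓢(E3, G)) = (∂_{v} f : 𝓢(E3, F)).postcompCLM L := by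
  ext x
  have h := L.hasFDerivAt.comp_hasDerivAt (0 : ℝ) (hasLineDerivAt_schwartz f x v)
  exact (hasLineDerivAt_schwartz (f.postcompCLM L) x v).unique h

theorem laplacian_postcomp (L : F →L[ℝ] G) (f : 𝓢(E3, F)) :
    Δ (f.postcompCLM L) = (Δ f).postcompCLM L := by
  rw [laplacian_eq_sum_e3, laplacian_eq_sum_e3, map_sum]
  simp only [lineDeriv_postcomp]

/-- The Schwartz function `x ↦ x_j f(x)`. -/
def coordMul (j : Fin 3) (f : 𝓢(E3, ℂ)) : 𝓢(E3, ℂ) :=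
  SchwartzMap.smulLeftCLM ℂ (fun x : E3 => x j) f

theorem coordMul_apply (j : Fin 3) (f : 𝓢(E3, ℂ)) (x : E3) : coordMul j f x = (x j : ℂ) * f x := by
  have h : Function.HasTemperateGrowth fun x : E3 => x j :=
    (EuclideanSpace.proj (𝕜 := ℝ) j).hasTemperateGrowth
  rw [coordMul, SchwartzMap.smulLeftCLM_apply_apply h, Complex.real_smul]

theorem lineDeriv_coordMul (j k : Fin 3) (f : 𝓢(E3, ℂ)) :
    (∂_{e3 k} (coordMul j f) : 𝓢(E3, ℂ)) =
      (if j = k then (1 : ℂ) else 0) • f + coordMul j (∂_{e3 k} f) := by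
  ext x
  refine (hasLineDerivAt_schwartz (coordMul j f) x (e3 k)).unique ?_
  have h1 : HasLineDerivAt ℝ (fun x : E3 => x j) (if j = k then 1 else 0) x (e3 k) := by
    have := ((EuclideanSpace.proj (𝕜 := ℝ) j : E3 →L[ℝ] ℝ).hasFDerivAt (x := x)).hasLineDerivAt (e3 k)
    simpa [e3, PiLp.single_apply] using this
  have h2 := hasLineDerivAt_schwartz f x (e3 k)
  unfold HasLineDerivAt at *
  have h3 := h1.ofReal_comp.mul h2
  have e : (fun t : ℝ => coordMul j f (x + t • e3 k)) =
      (fun t : ℝ => (((x + t • e3 k) j : ℝ) : ℂ)) * fun t : ℝ => f (x + t • e3 k) := by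
    ext t
    rw [coordMul_apply, Pi.mul_apply]
  rw [e]
  refine h3.congr_deriv ?_
  by_cases hjk : j = k <;> simp [coordMul_apply, hjk]

/-- Applied to the ground state, this Leibniz rule gives L₋(x_jφ) = -2∂_jφ, since the potential
commutes with x_j. -/
theorem laplacian_coordMul (j : Fin 3) (f : 𝓢(E3, ℂ)) (x : E3) :
    (Δ (coordMul j f)) x = (x j : ℂ) * (Δ f) x + 2 * (∂_{e3 j} f : 𝓢(E3, ℂ)) x := by
  rw [laplacian_eq_sum_e3, laplacian_eq_sum_e3]
  have : ∀ k, (∂_{e3 k} (∂_{e3 k} (coordMul j f)) : 𝓢(E3, ℂ)) x =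
      (x j : ℂ) * (∂_{e3 k} (∂_{e3 k} f) : 𝓢(E3, ℂ)) x +
        if j = k then 2 * (∂_{e3 k} f : 𝓢(E3, ℂ)) x else 0 := by
    intro k
    rw [lineDeriv_coordMul, LineDeriv.lineDerivOp_add, LineDeriv.lineDerivOp_smul,
      lineDeriv_coordMul]
    simp only [add_apply, smul_apply, coordMul_apply, smul_eq_mul]
    split_ifs <;> ring
  rw [sum_apply, sum_apply]
  simp only [this, Finset.sum_add_distrib, Finset.mul_sum]
  simp

end Schwartz

section Compose

variable {F G : Type} [NormedAddCommGroup F] [NormedSpace ℂ F]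
  [NormedAddCommGroup G] [NormedSpace ℂ G]

theorem integrable_schwartz_smul (ψ : 𝓢(E3, ℂ)) (u : L2 F) : Integrable fun x => ψ x • u x :=
  memLp_one_iff_integrable.1 ((Lp.memLp u).smul (ψ.memLp 2))

variable [CompleteSpace F] [CompleteSpace G]

theorem IsLaplacian.compLp (L : F →L[ℂ] G) {u w : L2 F} (h : IsLaplacian u w) :
    IsLaplacian (L.compLp u) (L.compLp w) := by
  rw [isLaplacian_iff] at h ⊢
  intro ψ
  have key : ∀ (ψ : 𝓢(E3, ℂ)) (u : L2 F), ∫ x, ψ x • L.compLp u x = L (∫ x, ψ x • u x) := by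
    intro ψ u
    rw [← L.integral_comp_comm (integrable_schwartz_smul ψ u)]
    refine integral_congr_ae ?_
    filter_upwards [L.coeFn_compLp u] with x hx
    rw [hx, map_smul]
  rw [key, key, h ψ]

/-- The complex conjugate in `L²`. -/
def conjL2 (u : L2 ℂ) : L2 ℂ := (Complex.conjCLE : ℂ →L[ℝ] ℂ).compLp u

theorem coeFn_conjL2 (u : L2 ℂ) : conjL2 u =ᵐ[volume] fun x => conj (u x) :=
  (Complex.conjCLE : ℂ →L[ℝ] ℂ).coeFn_compLp u

/-- Conjugation is moved onto the test function, where it commutes with the real operator Δ. -/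
theorem IsLaplacian.conj {u w : L2 ℂ} (h : IsLaplacian u w) :
    IsLaplacian (conjL2 u) (conjL2 w) := by
  rw [isLaplacian_iff] at h ⊢
  intro ψ
  have key : ∀ (ψ : 𝓢(E3, ℂ)) (u : L2 ℂ), ∫ x, ψ x • conjL2 u x =
      starRingEnd ℂ (∫ x, (ψ.postcompCLM (Complex.conjCLE : ℂ →L[ℝ] ℂ)) x • u x) := by
    intro ψ u
    rw [← integral_conj]
    refine integral_congr_ae ?_
    filter_upwards [coeFn_conjL2 u] with x hx
    rw [hx]
    simp
  rw [key, key, h, laplacian_postcomp]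

theorem IsLaplacian.add {u w u' w' : L2 F} (h : IsLaplacian u w) (h' : IsLaplacian u' w') :
    IsLaplacian (u + u') (w + w') := by
  rw [IsLaplacian] at *
  rw [← TemperedDistribution.laplacianCLM_apply] at *
  simp only [← Lp.toTemperedDistributionCLM_apply, map_add] at *
  rw [h, h']

theorem IsLaplacian.smul (c : ℂ) {u w : L2 F} (h : IsLaplacian u w) :
    IsLaplacian (c • u) (c • w) := by
  rw [IsLaplacian] at *
  rw [← TemperedDistribution.laplacianCLM_apply] at *
  simp only [← Lp.toTemperedDistributionCLM_apply, map_smul] at *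
  rw [h]

theorem IsLaplacian.unique {u w w' : L2 F} (h : IsLaplacian u w) (h' : IsLaplacian u w') :
    w = w' :=
  toTemperedDistribution_injective (h.trans h'.symm)

end Compose

/-! ### Schrödinger operators with a real potential -/

/-- The graph of `-Δ + W`. -/
def SchrodingerGraph (W : E3 → ℝ) (u f : L2 ℂ) : Prop :=
  ∃ w : L2 ℂ, IsLaplacian u w ∧ ∀ᵐ x, f x = -w x + W x * u x

section Schrodinger

variable {W : E3 → ℝ} {u u' f f' : L2 ℂ}

theorem SchrodingerGraph.add (h : SchrodingerGraph W u f) (h' : SchrodingerGraph W u' f') :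
    SchrodingerGraph W (u + u') (f + f') := by
  obtain ⟨w, hw, hf⟩ := h
  obtain ⟨w', hw', hf'⟩ := h'
  refine ⟨w + w', hw.add hw', ?_⟩
  filter_upwards [hf, hf', Lp.coeFn_add u u', Lp.coeFn_add f f', Lp.coeFn_add w w']
    with x h1 h2 h3 h4 h5
  rw [h3, h4, h5, Pi.add_apply, Pi.add_apply, Pi.add_apply, h1, h2]
  ring

theorem SchrodingerGraph.smul (c : ℂ) (h : SchrodingerGraph W u f) :
    SchrodingerGraph W (c • u) (c • f) := by
  obtain ⟨w, hw, hf⟩ := h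
  refine ⟨c • w, hw.smul c, ?_⟩
  filter_upwards [hf, Lp.coeFn_smul c u, Lp.coeFn_smul c f, Lp.coeFn_smul c w] with x h1 h3 h4 h5
  rw [h3, h4, h5, Pi.smul_apply, Pi.smul_apply, Pi.smul_apply, h1]
  simp only [smul_eq_mul]
  ring

theorem SchrodingerGraph.sub (h : SchrodingerGraph W u f) (h' : SchrodingerGraph W u' f') :
    SchrodingerGraph W (u - u') (f - f') := by
  simpa [sub_eq_add_neg] using h.add (h'.smul (-1))

theorem schrodingerGraph_toL2 {ψ g : 𝓢(E3, ℂ)} (h : ∀ᵐ x, g x = -(Δ ψ) x + W x * ψ x) :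
    SchrodingerGraph W (toL2 ψ) (toL2 g) := by
  refine ⟨_, isLaplacian_toLp ψ, ?_⟩
  filter_upwards [h, ψ.coeFn_toLp 2, g.coeFn_toLp 2, (Δ ψ).coeFn_toLp 2] with x h1 h2 h3 h4
  rw [h2, h3, h4, h1]

/-- The range of `-Δ + W` is orthogonal to its kernel. -/
theorem SchrodingerGraph.integral_mul_eq_zero {ψ : 𝓢(E3, ℂ)} (h : SchrodingerGraph W u f)
    (hψ : ∀ᵐ x, (Δ ψ) x = W x * ψ x) : ∫ x, ψ x * f x = 0 := by
  obtain ⟨w, hw, hf⟩ := h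
  have h1 := isLaplacian_iff.1 hw ψ
  have h2 : ∫ x, ψ x * f x = ∫ x, ((Δ ψ) x • u x - ψ x • w x) := by
    refine integral_congr_ae ?_
    filter_upwards [hf, hψ] with x h3 h4
    rw [h3, h4]
    simp only [smul_eq_mul]
    ring
  rw [h2, integral_sub (integrable_schwartz_smul _ u) (integrable_schwartz_smul _ w), h1, sub_self]

end Schrodinger

end

noncomputable section

open Filter Topology ComplexConjugate

/-! ### Real and imaginary parts, components -/

/-- The real part in `L²`. -/
def reL2 (u : L2 ℂ) : L2 ℂ := (1 / 2 : ℂ) • (u + conjL2 u)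

/-- The imaginary part in `L²`. -/
def imL2 (u : L2 ℂ) : L2 ℂ := (-Complex.I / 2 : ℂ) • (u + (-1 : ℂ) • conjL2 u)

theorem coeFn_reL2 (u : L2 ℂ) : ∀ᵐ x, reL2 u x = ((u x).re : ℂ) := by
  filter_upwards [Lp.coeFn_smul (1 / 2 : ℂ) (u + conjL2 u), Lp.coeFn_add u (conjL2 u),
    coeFn_conjL2 u] with x h1 h2 h3
  rw [reL2, h1, Pi.smul_apply, h2, Pi.add_apply, h3, Complex.re_eq_add_conj, smul_eq_mul]
  ring

theorem coeFn_imL2 (u : L2 ℂ) : ∀ᵐ x, imL2 u x = ((u x).im : ℂ) := by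
  filter_upwards [Lp.coeFn_smul (-Complex.I / 2 : ℂ) (u + (-1 : ℂ) • conjL2 u),
    Lp.coeFn_add u ((-1 : ℂ) • conjL2 u), Lp.coeFn_smul (-1 : ℂ) (conjL2 u), coeFn_conjL2 u]
    with x h1 h2 h3 h4
  rw [imL2, h1, Pi.smul_apply, h2, Pi.add_apply, h3, Pi.smul_apply, h4, Complex.im_eq_sub_conj,
    smul_eq_mul, smul_eq_mul]
  have : Complex.I ≠ 0 := Complex.I_ne_zero
  field_simp
  rw [Complex.I_sq]
  ring

theorem IsLaplacian.reL2 {u w : L2 ℂ} (h : IsLaplacian u w) : IsLaplacian (reL2 u) (reL2 w) :=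
  (h.add h.conj).smul _

theorem IsLaplacian.imL2 {u w : L2 ℂ} (h : IsLaplacian u w) : IsLaplacian (imL2 u) (imL2 w) :=
  (h.add (h.conj.smul _)).smul _

/-- The components of an element of `L²(ℝ³, ℂ²)`. -/
def compL2 (i : Fin 2) (u : L2 C2) : L2 ℂ :=
  (EuclideanSpace.proj i : C2 →L[ℂ] ℂ).compLp u

theorem coeFn_compL2 (i : Fin 2) (u : L2 C2) : ∀ᵐ x, compL2 i u x = u x i :=
  (EuclideanSpace.proj i : C2 →L[ℂ] ℂ).coeFn_compLp u

theorem IsLaplacian.compL2 (i : Fin 2) {u w : L2 C2} (h : IsLaplacian u w) :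
    IsLaplacian (compL2 i u) (compL2 i w) :=
  h.compLp _

/-- The embedding of `ℂ` as the `i`-th coordinate line of `ℂ²`. -/
def coordEmb (i : Fin 2) : ℂ →L[ℝ] C2 :=
  (ContinuousLinearMap.toSpanSingleton ℂ (EuclideanSpace.single i (1 : ℂ))).restrictScalars ℝ

theorem coordEmb_apply (i : Fin 2) (z : ℂ) : coordEmb i z = EuclideanSpace.single i z := by
  ext k
  simp [coordEmb, PiLp.single_apply]

/-- The Schwartz function with components `f` and `g`. -/
def pairFn (f g : 𝓢(E3, ℂ)) : 𝓢(E3, C2) :=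
  f.postcompCLM (coordEmb 0) + g.postcompCLM (coordEmb 1)

theorem pairFn_apply (f g : 𝓢(E3, ℂ)) (x : E3) : pairFn f g x = !₂[f x, g x] := by
  ext k
  fin_cases k <;> simp [pairFn, coordEmb_apply]

theorem laplacian_pairFn (f g : 𝓢(E3, ℂ)) : Δ (pairFn f g) = pairFn (Δ f) (Δ g) := by
  rw [pairFn, ← SchwartzMap.laplacianCLM_eq', map_add, SchwartzMap.laplacianCLM_eq',
    SchwartzMap.laplacianCLM_eq', laplacian_postcomp, laplacian_postcomp, pairFn]

theorem eq_toL2_pairFn {u : L2 C2} {f g : 𝓢(E3, ℂ)} (h0 : compL2 0 u = toL2 f)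
    (h1 : compL2 1 u = toL2 g) : u = toL2 (pairFn f g) := by
  refine Lp.ext ?_
  have c0 := coeFn_compL2 0 u
  have c1 := coeFn_compL2 1 u
  rw [h0] at c0
  rw [h1] at c1
  filter_upwards [c0, c1, f.coeFn_toLp 2, g.coeFn_toLp 2, (pairFn f g).coeFn_toLp 2]
    with x a0 a1 a2 a3 a4
  rw [a4, pairFn_apply]
  ext k
  fin_cases k
  · simpa [← a2] using a0.symm
  · simpa [← a3] using a1.symm

theorem compL2_zero_pairFn (f g : 𝓢(E3, ℂ)) : compL2 0 (toL2 (pairFn f g)) = toL2 f := by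
  refine Lp.ext ?_
  filter_upwards [coeFn_compL2 0 (toL2 (pairFn f g)), f.coeFn_toLp 2, (pairFn f g).coeFn_toLp 2]
    with x a0 a1 a2
  rw [a0, a1, a2, pairFn_apply]
  simp

theorem compL2_one_pairFn (f g : 𝓢(E3, ℂ)) : compL2 1 (toL2 (pairFn f g)) = toL2 g := by
  refine Lp.ext ?_
  filter_upwards [coeFn_compL2 1 (toL2 (pairFn f g)), g.coeFn_toLp 2, (pairFn f g).coeFn_toLp 2]
    with x a0 a1 a2
  rw [a0, a1, a2, pairFn_apply]
  simp

theorem reL2_toL2_add {f g : 𝓢(E3, ℂ)} (hf : ∀ x, (f x).im = 0) (hg : ∀ x, (g x).im = 0) :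
    reL2 (toL2 (f + Complex.I • g)) = toL2 f := by
  refine Lp.ext ?_
  filter_upwards [coeFn_reL2 (toL2 (f + Complex.I • g)), f.coeFn_toLp 2,
    (f + Complex.I • g).coeFn_toLp 2] with x a0 a1 a2
  rw [a0, a1, a2]
  apply Complex.ext <;> simp [hf x, hg x]

theorem imL2_toL2_add {f g : 𝓢(E3, ℂ)} (hf : ∀ x, (f x).im = 0) (hg : ∀ x, (g x).im = 0) :
    imL2 (toL2 (f + Complex.I • g)) = toL2 g := by
  refine Lp.ext ?_
  filter_upwards [coeFn_imL2 (toL2 (f + Complex.I • g)), g.coeFn_toLp 2,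
    (f + Complex.I • g).coeFn_toLp 2] with x a0 a1 a2
  rw [a0, a1, a2]
  apply Complex.ext <;> simp [hf x, hg x]

theorem reL2_add_I_smul_imL2 (u : L2 ℂ) : reL2 u + Complex.I • imL2 u = u := by
  refine Lp.ext ?_
  filter_upwards [coeFn_reL2 u, coeFn_imL2 u, Lp.coeFn_add (reL2 u) (Complex.I • imL2 u),
    Lp.coeFn_smul Complex.I (imL2 u)] with x a0 a1 a2 a3
  rw [a2, Pi.add_apply, a3, Pi.smul_apply, a0, a1, smul_eq_mul, mul_comm, Complex.re_add_im]

/-- The kernels of L₊ and L₋ are complex spaces, whereas the unknowns a and b are real; this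
discards the imaginary parts of the coefficients. -/
theorem eq_toL2_of_reL2_eq {a : L2 ℂ} {f g : 𝓢(E3, ℂ)} (ha : reL2 a = a)
    (hf : ∀ x, (f x).im = 0) (hg : ∀ x, (g x).im = 0) (h : a = toL2 (f + Complex.I • g)) :
    a = toL2 f := by
  rw [← ha, h, reL2_toL2_add hf hg]

theorem reL2_reL2 (u : L2 ℂ) : reL2 (reL2 u) = reL2 u := by
  refine Lp.ext ?_
  filter_upwards [coeFn_reL2 (reL2 u), coeFn_reL2 u] with x h1 h2
  rw [h1, h2, Complex.ofReal_re]

theorem reL2_imL2 (u : L2 ℂ) : reL2 (imL2 u) = imL2 u := by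
  refine Lp.ext ?_
  filter_upwards [coeFn_reL2 (imL2 u), coeFn_imL2 u] with x h1 h2
  rw [h1, h2, Complex.ofReal_re]

theorem integral_mul_toL2 (ψ f : 𝓢(E3, ℂ)) : ∫ x, ψ x * toL2 f x = ∫ x, ψ x * f x := by
  refine integral_congr_ae ?_
  filter_upwards [f.coeFn_toLp 2] with x hx
  rw [hx]

theorem integrable_schwartz_mul (ψ f : 𝓢(E3, ℂ)) : Integrable fun x => ψ x * f x := by
  refine (integrable_schwartz_smul ψ (toL2 f)).congr ?_
  filter_upwards [f.coeFn_toLp 2] with x hx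
  rw [hx, smul_eq_mul]

theorem integral_mul_lineDeriv_self (φ : 𝓢(E3, ℂ)) (k : Fin 3) :
    ∫ x, φ x * (∂_{e3 k} φ : 𝓢(E3, ℂ)) x = 0 := by
  have h := SchwartzMap.integral_mul_lineDerivOp_right_eq_neg_left (μ := volume) φ φ (e3 k)
  have h2 : ∫ x, (∂_{e3 k} φ : 𝓢(E3, ℂ)) x * φ x = ∫ x, φ x * (∂_{e3 k} φ : 𝓢(E3, ℂ)) x := by
    simp only [mul_comm]
  rw [h2] at h
  exact self_eq_neg.1 h

/-- Integrating by parts returns the same integral with opposite sign, plus δ_jk∫φ². This duality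
between x_jφ and ∂_kφ serves both the solvability conditions and linear independence. -/
theorem integral_coordMul_mul_lineDeriv (φ : 𝓢(E3, ℂ)) (j k : Fin 3) :
    ∫ x, coordMul j φ x * (∂_{e3 k} φ : 𝓢(E3, ℂ)) x =
      if j = k then -(∫ x, φ x * φ x) / 2 else 0 := by
  have h := SchwartzMap.integral_mul_lineDerivOp_right_eq_neg_left (μ := volume)
    (coordMul j φ) φ (e3 k)
  have h2 : ∫ x, (∂_{e3 k} (coordMul j φ) : 𝓢(E3, ℂ)) x * φ x =
      (if j = k then (1 : ℂ) else 0) * (∫ x, φ x * φ x) +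
        ∫ x, coordMul j φ x * (∂_{e3 k} φ : 𝓢(E3, ℂ)) x := by
    rw [← integral_const_mul, ← integral_add ((integrable_schwartz_mul φ φ).const_mul _)
      (integrable_schwartz_mul _ _)]
    refine integral_congr_ae (Eventually.of_forall fun x => ?_)
    simp only [lineDeriv_coordMul, add_apply, smul_apply, smul_eq_mul, coordMul_apply]
    ring
  rw [h2] at h
  split_ifs at h ⊢ with hjk
  · linear_combination h / 2
  · linear_combination h / 2

/-! ### The generalized kernel -/

/-- The function `∑ r_j ∂_jφ + s φ'` for real coefficients. -/
def realWave (φ φ' : 𝓢(E3, ℂ)) (r : Fin 3 → ℝ) (s : ℝ) : 𝓢(E3, ℂ) :=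
  ∑ j, (r j : ℂ) • (∂_{e3 j} φ : 𝓢(E3, ℂ)) + (s : ℂ) • φ'

/-- `∑ t_j x_jφ + q φ`. -/
def imagWave (φ : 𝓢(E3, ℂ)) (t : Fin 3 → ℝ) (q : ℝ) : 𝓢(E3, ℂ) :=
  ∑ j, (t j : ℂ) • coordMul j φ + (q : ℂ) • φ

/-- `(∑ r_j ∂_jφ + s φ' + i (∑ t_j x_jφ + q φ), c φ)`. -/
def wave (φ φ' : 𝓢(E3, ℂ)) (r : Fin 3 → ℝ) (s : ℝ) (t : Fin 3 → ℝ) (q : ℝ) (c : ℂ) :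
    𝓢(E3, C2) :=
  pairFn (realWave φ φ' r s + Complex.I • imagWave φ t q) (c • φ)

theorem realWave_apply (φ φ' : 𝓢(E3, ℂ)) (r : Fin 3 → ℝ) (s : ℝ) (x : E3) :
    realWave φ φ' r s x = ∑ j, (r j : ℂ) * (∂_{e3 j} φ : 𝓢(E3, ℂ)) x + s * φ' x := by
  simp [realWave]

theorem imagWave_apply (φ : 𝓢(E3, ℂ)) (t : Fin 3 → ℝ) (q : ℝ) (x : E3) :
    imagWave φ t q x = ∑ j, (t j : ℂ) * ((x j : ℂ) * φ x) + q * φ x := by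
  simp [imagWave, coordMul_apply]

/-- The properties of a ground state `φ` and of its derivative `φ'` in the parameter which
determine the generalized kernel; `V` and `Vp` are the potentials of `L₋` and `L₊`. -/
structure GroundData (V Vp : E3 → ℝ) (φ φ' : 𝓢(E3, ℂ)) : Prop where
  im_eq_zero : ∀ x, (φ x).im = 0
  ne_zero : ∀ x, φ x ≠ 0
  im_deriv_eq_zero : ∀ x, (φ' x).im = 0
  bounded : ∃ K, ∀ x, |V x| ≤ K
  laplacian : ∀ x, (Δ φ) x = V x * φ x
  laplacian_deriv : ∀ x, (Δ φ') x = Vp x * φ' x + φ x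
  laplacian_lineDeriv : ∀ j, ∀ᵐ x, (Δ (∂_{e3 j} φ : 𝓢(E3, ℂ))) x = Vp x * (∂_{e3 j} φ : 𝓢(E3, ℂ)) x
  integral_mul_deriv_ne_zero : ∫ x, φ x * φ' x ≠ 0
  mem_span_of_schrodingerGraph : ∀ u, SchrodingerGraph Vp u 0 →
    u ∈ Submodule.span ℂ (range fun j : Fin 3 => toL2 (∂_{e3 j} φ : 𝓢(E3, ℂ)))

namespace GroundData

variable {V Vp : E3 → ℝ} {φ φ' : 𝓢(E3, ℂ)}

theorem im_realWave (G : GroundData V Vp φ φ') (r : Fin 3 → ℝ) (s : ℝ) (x : E3) :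
    (realWave φ φ' r s x).im = 0 := by
  have h := fun j => im_lineDeriv_eq_zero G.im_eq_zero (e3 j) x
  simp [realWave_apply, Complex.im_sum, h, G.im_deriv_eq_zero x]

theorem im_imagWave (G : GroundData V Vp φ φ') (t : Fin 3 → ℝ) (q : ℝ) (x : E3) :
    (imagWave φ t q x).im = 0 := by
  simp [imagWave_apply, Complex.im_sum, G.im_eq_zero x]

theorem integral_mul_self_ne_zero (G : GroundData V Vp φ φ') : ∫ x, φ x * φ x ≠ 0 := by
  have h1 : ∀ x, φ x * φ x = ((‖φ x‖ ^ 2 : ℝ) : ℂ) := fun x => by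
    have := Complex.conj_eq_iff_im.2 (G.im_eq_zero x)
    rw [Complex.ofReal_pow, ← Complex.conj_mul', this]
  simp only [h1]
  rw [integral_complex_ofReal, Complex.ofReal_ne_zero]
  refine ne_of_gt ((integral_pos_iff_support_of_nonneg (fun x => by positivity)
    (integrable_norm_sq_schwartz φ)).2 ?_)
  have : Function.support (fun x => ‖φ x‖ ^ 2) = univ := by
    ext x
    simp [G.ne_zero x]
  rw [this]
  exact Measure.measure_univ_pos.2 (NeZero.ne _)

theorem integral_mul_realWave (φ φ' : 𝓢(E3, ℂ)) (ψ : 𝓢(E3, ℂ)) (r : Fin 3 → ℝ) (s : ℝ) :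
    ∫ x, ψ x * realWave φ φ' r s x =
      ∑ j, (r j : ℂ) * (∫ x, ψ x * (∂_{e3 j} φ : 𝓢(E3, ℂ)) x) + s * ∫ x, ψ x * φ' x := by
  have hi := fun f => integrable_schwartz_mul ψ f
  simp only [← integral_const_mul]
  rw [← integral_finsetSum _ fun j _ => (hi _).const_mul _, ← integral_add
    (integrable_finsetSum _ fun j _ => (hi _).const_mul _) ((hi _).const_mul _)]
  refine integral_congr_ae (Eventually.of_forall fun x => ?_)
  simp only [realWave_apply, mul_add, Finset.mul_sum]
  congr 1
  · exact Finset.sum_congr rfl fun j _ => by ring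
  · ring

theorem integral_mul_imagWave (φ : 𝓢(E3, ℂ)) (ψ : 𝓢(E3, ℂ)) (t : Fin 3 → ℝ) (q : ℝ) :
    ∫ x, ψ x * imagWave φ t q x =
      ∑ j, (t j : ℂ) * (∫ x, ψ x * coordMul j φ x) + q * ∫ x, ψ x * φ x := by
  have hi := fun f => integrable_schwartz_mul ψ f
  simp only [← integral_const_mul]
  rw [← integral_finsetSum _ fun j _ => (hi _).const_mul _, ← integral_add
    (integrable_finsetSum _ fun j _ => (hi _).const_mul _) ((hi _).const_mul _)]
  refine integral_congr_ae (Eventually.of_forall fun x => ?_)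
  simp only [imagWave_apply, coordMul_apply, mul_add, Finset.mul_sum]
  congr 1
  · exact Finset.sum_congr rfl fun j _ => by ring
  · ring

theorem integral_self_mul_realWave (r : Fin 3 → ℝ) (s : ℝ) :
    ∫ x, φ x * realWave φ φ' r s x = s * ∫ x, φ x * φ' x := by
  rw [integral_mul_realWave]
  simp [integral_mul_lineDeriv_self]

theorem integral_lineDeriv_mul_imagWave (t : Fin 3 → ℝ) (q : ℝ) (k : Fin 3) :
    ∫ x, (∂_{e3 k} φ : 𝓢(E3, ℂ)) x * imagWave φ t q x = -(t k : ℂ) * (∫ x, φ x * φ x) / 2 := by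
  have h1 := integral_mul_lineDeriv_self φ k
  have h2 := fun j => integral_coordMul_mul_lineDeriv φ j k
  simp only [mul_comm _ ((∂_{e3 k} φ : 𝓢(E3, ℂ)) _)] at h1 h2
  rw [integral_mul_imagWave, h1]
  simp only [h2]
  simp
  ring

/-- Pair with φ ∈ ker L₋: the ∂_jφ drop out, being orthogonal to φ, and s∫φφ' = 0 remains. No Jordan
chain continues past φ'. -/
theorem eq_zero_of_schrodingerGraph_realWave (G : GroundData V Vp φ φ') {b : L2 ℂ}
    {r : Fin 3 → ℝ} {s : ℝ} (h : SchrodingerGraph V b (toL2 (realWave φ φ' r s))) : s = 0 := by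
  have h1 := h.integral_mul_eq_zero (Eventually.of_forall G.laplacian)
  rw [integral_mul_toL2, integral_self_mul_realWave] at h1
  simpa [G.integral_mul_deriv_ne_zero] using h1

/-- Pair with ∂_kφ ∈ ker L₊: only -t_k∫φ²/2 survives. No Jordan chain continues past x_kφ. -/
theorem eq_zero_of_schrodingerGraph_imagWave (G : GroundData V Vp φ φ') {a : L2 ℂ}
    {t : Fin 3 → ℝ} {q : ℝ} (h : SchrodingerGraph Vp a (toL2 (imagWave φ t q))) : t = 0 := by
  ext k
  have h1 := h.integral_mul_eq_zero (G.laplacian_lineDeriv k)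
  rw [integral_mul_toL2, integral_lineDeriv_mul_imagWave] at h1
  simpa [G.integral_mul_self_ne_zero] using h1

theorem eq_zero_of_schrodingerGraph_smul (G : GroundData V Vp φ φ') {u : L2 ℂ} {c : ℂ}
    (h : SchrodingerGraph V u (toL2 (c • φ))) : c = 0 := by
  have h1 := h.integral_mul_eq_zero (Eventually.of_forall G.laplacian)
  rw [integral_mul_toL2] at h1
  have h2 : ∫ x, φ x * (c • φ) x = c * ∫ x, φ x * φ x := by
    rw [← integral_const_mul]
    refine integral_congr_ae (Eventually.of_forall fun x => ?_)
    simp only [smul_apply, smul_eq_mul]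
    ring
  rw [h2] at h1
  simpa [G.integral_mul_self_ne_zero] using h1

theorem laplacian_realWave (φ φ' : 𝓢(E3, ℂ)) (r : Fin 3 → ℝ) (s : ℝ) (x : E3) :
    (Δ (realWave φ φ' r s)) x =
      ∑ j, (r j : ℂ) * (Δ (∂_{e3 j} φ : 𝓢(E3, ℂ))) x + s * (Δ φ') x := by
  simp only [realWave, ← SchwartzMap.laplacianCLM_eq ℂ, map_add, map_sum, map_smul]
  simp

theorem laplacian_imagWave (φ : 𝓢(E3, ℂ)) (t : Fin 3 → ℝ) (q : ℝ) (x : E3) :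
    (Δ (imagWave φ t q)) x = ∑ j, (t j : ℂ) * (Δ (coordMul j φ)) x + q * (Δ φ) x := by
  simp only [imagWave, ← SchwartzMap.laplacianCLM_eq ℂ, map_add, map_sum, map_smul]
  simp

/-- This is L₊∂_jφ = 0 together with L₊φ' = -φ. -/
theorem realWave_eq_schrodinger (G : GroundData V Vp φ φ') (r : Fin 3 → ℝ) (s : ℝ) :
    ∀ᵐ x, imagWave φ 0 (-s) x = -(Δ (realWave φ φ' r s)) x + Vp x * realWave φ φ' r s x := by
  filter_upwards [ae_all_iff.2 G.laplacian_lineDeriv] with x hx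
  rw [laplacian_realWave, realWave_apply, imagWave_apply, G.laplacian_deriv]
  simp only [hx, Fin.sum_univ_three, Pi.zero_apply]
  push_cast
  ring

/-- This is L₋φ = 0 together with L₋(x_jφ) = -2∂_jφ. -/
theorem imagWave_eq_schrodinger (G : GroundData V Vp φ φ') (t : Fin 3 → ℝ) (q : ℝ) (x : E3) :
    realWave φ φ' (fun j => -2 * t j) 0 x =
      -(Δ (imagWave φ t q)) x + V x * imagWave φ t q x := by
  rw [laplacian_imagWave, realWave_apply, imagWave_apply, G.laplacian]
  simp only [laplacian_coordMul, G.laplacian, Fin.sum_univ_three]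
  push_cast
  ring

theorem exists_eq_smul (G : GroundData V Vp φ φ') {u : L2 ℂ} (h : SchrodingerGraph V u 0) :
    ∃ c : ℂ, u = toL2 (c • φ) := by
  obtain ⟨w, hw, hf⟩ := h
  obtain ⟨K, hK⟩ := G.bounded
  obtain ⟨c, hc⟩ := eq_smul_of_isLaplacian G.im_eq_zero G.ne_zero G.laplacian hK hw (by
    filter_upwards [hf, Lp.coeFn_zero ℂ 2 (volume : Measure E3)] with x h1 h2
    rw [h2, Pi.zero_apply] at h1
    linear_combination h1)
  exact ⟨c, by rw [hc, toL2_smul]⟩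

theorem realWave_add_I_smul (φ φ' : 𝓢(E3, ℂ)) (c : Fin 3 → ℂ) :
    ∑ j, c j • (∂_{e3 j} φ : 𝓢(E3, ℂ)) = realWave φ φ' (fun j => (c j).re) 0 +
      Complex.I • realWave φ φ' (fun j => (c j).im) 0 := by
  ext x
  simp only [smul_apply, add_apply, realWave_apply, smul_eq_mul, Fin.sum_univ_three]
  conv_lhs => rw [← Complex.re_add_im (c 0), ← Complex.re_add_im (c 1), ← Complex.re_add_im (c 2)]
  push_cast
  ring

/-- Solvability forces t = 0, then -qφ' is a particular solution, and the remainder lies in ker L₊.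
-/
theorem exists_eq_realWave (G : GroundData V Vp φ φ') {a : L2 ℂ} {t : Fin 3 → ℝ} {q : ℝ}
    (ha : reL2 a = a) (h : SchrodingerGraph Vp a (toL2 (imagWave φ t q))) :
    ∃ r, a = toL2 (realWave φ φ' r (-q)) := by
  obtain rfl := G.eq_zero_of_schrodingerGraph_imagWave h
  have h1 := h.sub (schrodingerGraph_toL2 (G.realWave_eq_schrodinger 0 (-q)))
  rw [neg_neg, sub_self] at h1
  have h2 := G.mem_span_of_schrodingerGraph _ h1
  obtain ⟨c, hc⟩ := (Submodule.mem_span_range_iff_exists_fun ℂ).1 h2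
  have h3 : a = toL2 ((realWave φ φ' (fun j => (c j).re) (-q)) +
      Complex.I • realWave φ φ' (fun j => (c j).im) 0) := by
    rw [← sub_add_cancel a (toL2 (realWave φ φ' 0 (-q))), ← hc]
    simp only [← toL2_smul]
    have h4 : ∑ j, toL2 (c j • (∂_{e3 j} φ : 𝓢(E3, ℂ))) =
        toL2 (∑ j, c j • (∂_{e3 j} φ : 𝓢(E3, ℂ))) :=
      (map_sum (SchwartzMap.toLpCLM ℂ ℂ 2 (volume : Measure E3)) _ _).symm
    rw [h4, ← toL2_add, realWave_add_I_smul φ φ']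
    congr 1
    simp only [realWave]
    simp
    abel
  exact ⟨_, eq_toL2_of_reL2_eq ha (G.im_realWave _ _) (G.im_realWave _ _) h3⟩

/-- Solvability forces s = 0, then -½∑ r_jx_jφ is a particular solution, and the remainder lies in
ker L₋. -/
theorem exists_eq_imagWave (G : GroundData V Vp φ φ') {b : L2 ℂ} {r : Fin 3 → ℝ} {s : ℝ}
    (hb : reL2 b = b) (h : SchrodingerGraph V b (toL2 (realWave φ φ' r s))) :
    ∃ q, b = toL2 (imagWave φ (fun j => -(r j) / 2) q) := by
  obtain rfl := G.eq_zero_of_schrodingerGraph_realWave h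
  have h1 := h.sub (schrodingerGraph_toL2
    (Eventually.of_forall (G.imagWave_eq_schrodinger (fun j => -(r j) / 2) 0)))
  have e : (fun j => -2 * (-(r j) / 2)) = r := by
    ext j
    ring
  rw [e, sub_self] at h1
  obtain ⟨c, hc⟩ := G.exists_eq_smul h1
  have h3 : b = toL2 (imagWave φ (fun j => -(r j) / 2) c.re +
      Complex.I • imagWave φ 0 c.im) := by
    rw [← sub_add_cancel b (toL2 (imagWave φ (fun j => -(r j) / 2) 0)), hc, ← toL2_add]
    congr 1
    ext x
    simp only [add_apply, smul_apply, imagWave_apply, smul_eq_mul, Pi.zero_apply,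
      Fin.sum_univ_three]
    conv_lhs => rw [← Complex.re_add_im c]
    push_cast
    ring
  exact ⟨_, eq_toL2_of_reL2_eq hb (G.im_imagWave _ _) (G.im_imagWave _ _) h3⟩

end GroundData

end

/-! ### Reduction of H_p to L₊ and L₋, and its generalized kernel -/

noncomputable section

open Filter Topology ComplexConjugate

/-- The potential of `L₋`. -/
def potMinus (β : ℝ → ℝ) (ω : ℝ) (φ : 𝓢(E3, ℂ)) (x : E3) : ℝ := ω + β (‖φ x‖ ^ 2)

/-- The potential of `L₊`. -/
def potPlus (β : ℝ → ℝ) (ω : ℝ) (φ : 𝓢(E3, ℂ)) (x : E3) : ℝ :=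
  ω + β (‖φ x‖ ^ 2) + 2 * deriv β (‖φ x‖ ^ 2) * ‖φ x‖ ^ 2

theorem fderiv_nonlin {β : ℝ → ℝ} (hβ : Differentiable ℝ β) (z h : C2) :
    fderiv ℝ (nonlin β) z h =
      β (‖z‖ ^ 2) • h + (deriv β (‖z‖ ^ 2) * (2 * inner ℝ z h)) • z := by
  have h1 : HasFDerivAt (fun z : C2 => ‖z‖ ^ 2) (2 • innerSL ℝ z) z :=
    (hasStrictFDerivAt_norm_sq z).hasFDerivAt
  have h2 := ((hβ (‖z‖ ^ 2)).hasDerivAt.comp_hasFDerivAt z h1).smul (hasFDerivAt_id z)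
  have h3 : HasFDerivAt (nonlin β) _ z := h2
  rw [h3.fderiv]
  simp

theorem soliton_zero (φ : ℝ → 𝓢(E3, ℂ)) (ω : ℝ) (x : E3) :
    soliton φ ω 0 x = !₂[φ ω x, 0] := by
  ext k
  fin_cases k <;> simp [soliton, vecE1]

theorem sigma3_apply (z : C2) : sigma3 z = !₂[z 0, -z 1] := by
  ext k
  fin_cases k <;> simp [sigma3, Matrix.toLpLin_apply, dotProduct]

theorem sigma2_apply (z : C2) : sigma2 z = !₂[-Complex.I * z 1, Complex.I * z 0] := by
  ext k
  fin_cases k <;> simp [sigma2, Matrix.toLpLin_apply, dotProduct]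

theorem inner_C2 (z w : C2) : inner ℝ z w = (conj (z 0) * w 0).re + (conj (z 1) * w 1).re := by
  rw [PiLp.inner_apply]
  simp [Complex.inner]
  ring

/-- With φ real and in the first slot, the inner product of Φ with h is φ Re h₀, so β' acts on Re h₀
alone. At zero velocity the drift vanishes and λ·◇ leaves only the shift by ω. -/
theorem linearized_eq {β : ℝ → ℝ} (hβ : Differentiable ℝ β) {φ : ℝ → 𝓢(E3, ℂ)} {ω : ℝ} {x : E3}
    (him : (φ ω x).im = 0) (h w : C2) (d : Fin 3 → C2) :
    -(Complex.I • sigma3 (-w + fderiv ℝ (nonlin β) (soliton φ ω 0 x) h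
        - (∑ a : Fin 3, (-(0 : E3) a) • (-(Complex.I • sigma3 (d a)))
            + (-ω - ‖(0 : E3)‖ ^ 2 / 4) • h))) =
      !₂[-Complex.I * ((-w 0).re + potPlus β ω (φ ω) x * (h 0).re +
            Complex.I * ((-w 0).im + potMinus β ω (φ ω) x * (h 0).im)),
        Complex.I * (-w 1 + potMinus β ω (φ ω) x * h 1)] := by
  obtain ⟨a, ha⟩ : ∃ a : ℝ, φ ω x = a := ⟨(φ ω x).re, Complex.ext rfl (by simpa using him)⟩
  have hn : ‖(!₂[(a : ℂ), 0] : C2)‖ ^ 2 = ‖(a : ℂ)‖ ^ 2 := by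
    rw [EuclideanSpace.norm_sq_eq]
    simp
  rw [fderiv_nonlin hβ, sigma3_apply, soliton_zero, inner_C2, ha, hn]
  have h0 : h 0 = (h 0).re + (h 0).im * Complex.I := (Complex.re_add_im _).symm
  have w0 : w 0 = (w 0).re + (w 0).im * Complex.I := (Complex.re_add_im _).symm
  have hna : (‖(a : ℂ)‖ ^ 2 : ℝ) = a ^ 2 := by simp
  rw [hna]
  ext k
  fin_cases k
  · simp [potPlus, potMinus, ha]
    conv_lhs => rw [h0, w0]
    generalize β (a ^ 2) = b
    generalize deriv β (a ^ 2) = b'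
    apply Complex.ext <;> simp [← Complex.ofReal_pow] <;> ring
  · simp [potMinus, ha]
    generalize β (a ^ 2) = b
    apply Complex.ext <;> simp <;> ring

/-- Reading H u = f by components: L₊a = -Im f₀, L₋b = Re f₀ and L₋z = -if₁. -/
theorem HGraph.schrodingerGraph {β : ℝ → ℝ} (hβ : Differentiable ℝ β) {φ : ℝ → 𝓢(E3, ℂ)} {ω : ℝ}
    (him : ∀ x, (φ ω x).im = 0) {u f : L2 C2} (h : HGraph β φ ω 0 u f) :
    SchrodingerGraph (potPlus β ω (φ ω)) (reL2 (compL2 0 u)) ((-1 : ℂ) • imL2 (compL2 0 f)) ∧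
    SchrodingerGraph (potMinus β ω (φ ω)) (imL2 (compL2 0 u)) (reL2 (compL2 0 f)) ∧
    SchrodingerGraph (potMinus β ω (φ ω)) (compL2 1 u) ((-Complex.I) • compL2 1 f) := by
  obtain ⟨-, w, d, hw, -, hf⟩ := h
  have hf' : ∀ᵐ x, f x = !₂[-Complex.I * ((-w x 0).re + potPlus β ω (φ ω) x * (u x 0).re +
            Complex.I * ((-w x 0).im + potMinus β ω (φ ω) x * (u x 0).im)),
        Complex.I * (-w x 1 + potMinus β ω (φ ω) x * u x 1)] := by
    filter_upwards [hf] with x hx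
    rw [hx]
    exact linearized_eq hβ (him x) (u x) (w x) fun a => d a x
  refine ⟨⟨_, (hw.compL2 0).reL2, ?_⟩, ⟨_, (hw.compL2 0).imL2, ?_⟩, ⟨_, hw.compL2 1, ?_⟩⟩
  · filter_upwards [hf', Lp.coeFn_smul (-1 : ℂ) (imL2 (compL2 0 f)), coeFn_imL2 (compL2 0 f),
      coeFn_compL2 0 f, coeFn_reL2 (compL2 0 u), coeFn_compL2 0 u, coeFn_reL2 (compL2 0 w),
      coeFn_compL2 0 w] with x h1 h2 h3 h4 h5 h6 h7 h8
    rw [h2, Pi.smul_apply, h3, h4, h5, h6, h7, h8, h1]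
    apply Complex.ext <;> simp
  · filter_upwards [hf', coeFn_reL2 (compL2 0 f),
      coeFn_compL2 0 f, coeFn_imL2 (compL2 0 u), coeFn_compL2 0 u, coeFn_imL2 (compL2 0 w),
      coeFn_compL2 0 w] with x h1 h3 h4 h5 h6 h7 h8
    rw [h3, h4, h5, h6, h7, h8, h1]
    apply Complex.ext <;> simp
  · filter_upwards [hf', Lp.coeFn_smul (-Complex.I) (compL2 1 f), coeFn_compL2 1 f,
      coeFn_compL2 1 u, coeFn_compL2 1 w] with x h1 h2 h3 h4 h5
    rw [h2, Pi.smul_apply, h3, h4, h5, h1]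
    apply Complex.ext <;> simp

section Kernel

variable {β : ℝ → ℝ} {φ : ℝ → 𝓢(E3, ℂ)} {ω : ℝ} {φ' : 𝓢(E3, ℂ)}

/-- Solutions of `H u = f` for `f` in the candidate for the generalized kernel. -/
theorem HGraph.exists_eq_wave (hβ : Differentiable ℝ β)
    (G : GroundData (potMinus β ω (φ ω)) (potPlus β ω (φ ω)) (φ ω) φ') {u : L2 C2}
    {r : Fin 3 → ℝ} {s : ℝ} {t : Fin 3 → ℝ} {q : ℝ} {c : ℂ}
    (h : HGraph β φ ω 0 u (toL2 (wave (φ ω) φ' r s t q c))) :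
    ∃ r' q' c', u = toL2 (wave (φ ω) φ' r' q (fun j => -(r j) / 2) q' c') := by
  obtain ⟨ha, hb, hc⟩ := h.schrodingerGraph hβ G.im_eq_zero
  rw [wave, compL2_zero_pairFn, imL2_toL2_add (G.im_realWave _ _) (G.im_imagWave _ _)] at ha
  rw [wave, compL2_zero_pairFn, reL2_toL2_add (G.im_realWave _ _) (G.im_imagWave _ _)] at hb
  rw [wave, compL2_one_pairFn, ← toL2_smul, smul_smul] at hc
  have e : (-1 : ℂ) • toL2 (imagWave (φ ω) t q) =
      toL2 (imagWave (φ ω) (fun j => -(t j)) (-q)) := by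
    rw [← toL2_smul]
    congr 1
    ext x
    simp only [smul_apply, imagWave_apply, smul_eq_mul, Fin.sum_univ_three]
    push_cast
    ring
  rw [e] at ha
  obtain ⟨r', hr'⟩ := G.exists_eq_realWave (reL2_reL2 _) ha
  obtain ⟨q', hq'⟩ := G.exists_eq_imagWave (reL2_imL2 _) hb
  -- A second component cφ on the right is solvable only for c = 0, so z lies in ker L₋.
  have hc0 := G.eq_zero_of_schrodingerGraph_smul hc
  rw [hc0, zero_smul] at hc
  have hz : toL2 (0 : 𝓢(E3, ℂ)) = 0 := (SchwartzMap.toLpCLM ℂ ℂ 2 (volume : Measure E3)).map_zero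
  rw [hz] at hc
  obtain ⟨c', hc'⟩ := G.exists_eq_smul hc
  refine ⟨r', q', c', eq_toL2_pairFn ?_ hc'⟩
  rw [← reL2_add_I_smul_imL2 (compL2 0 u), hr', hq', ← toL2_smul, ← toL2_add, neg_neg]

/-- On parameters H is (r, s, t, q, c) ↦ (-2t, 0, 0, s, 0), whose square is zero. -/
theorem hGraph_wave (hβ : Differentiable ℝ β)
    (G : GroundData (potMinus β ω (φ ω)) (potPlus β ω (φ ω)) (φ ω) φ') (r : Fin 3 → ℝ) (s : ℝ)
    (t : Fin 3 → ℝ) (q : ℝ) (c : ℂ) :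
    HGraph β φ ω 0 (toL2 (wave (φ ω) φ' r s t q c))
      (toL2 (wave (φ ω) φ' (fun j => -2 * t j) 0 0 s 0)) := by
  refine ⟨(isLaplacian_toLp _).memH2, _, _, isLaplacian_toLp _, fun a => isPartial_toLp a _, ?_⟩
  set f := wave (φ ω) φ' r s t q c with hf
  set g := wave (φ ω) φ' (fun j => -2 * t j) 0 0 s 0 with hg
  filter_upwards [f.coeFn_toLp 2, g.coeFn_toLp 2, (Δ f).coeFn_toLp 2,
    G.realWave_eq_schrodinger r s] with x h1 h2 h3 h4
  rw [linearized_eq hβ (G.im_eq_zero x), h1, h2, h3]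
  have h5 := G.imagWave_eq_schrodinger t q x
  have h6 := G.laplacian x
  have i1 := G.im_realWave r s x
  have i2 := G.im_imagWave t q x
  have i4 := G.im_imagWave 0 (-s) x
  have hL : Δ (realWave (φ ω) φ' r s + Complex.I • imagWave (φ ω) t q) =
      Δ (realWave (φ ω) φ' r s) + Complex.I • Δ (imagWave (φ ω) t q) := by
    simp only [← SchwartzMap.laplacianCLM_eq ℂ, map_add, map_smul]
  have hL2 : Δ (c • φ ω) = c • Δ (φ ω) := by
    simp only [← SchwartzMap.laplacianCLM_eq ℂ, map_smul]
  have hneg : imagWave (φ ω) 0 s x = -imagWave (φ ω) 0 (-s) x := by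
    simp [imagWave_apply]
  rw [hf, hg, wave, wave, laplacian_pairFn, pairFn_apply, pairFn_apply, pairFn_apply, hL, hL2]
  have k1 : (Δ (realWave (φ ω) φ' r s)) x = potPlus β ω (φ ω) x * realWave (φ ω) φ' r s x -
      imagWave (φ ω) 0 (-s) x := by linear_combination h4
  have k2 : (Δ (imagWave (φ ω) t q)) x = potMinus β ω (φ ω) x * imagWave (φ ω) t q x -
      realWave (φ ω) φ' (fun j => -2 * t j) 0 x := by linear_combination h5
  ext k
  fin_cases k
  · simp [k1, k2, hneg]
    apply Complex.ext <;> simp [i1, i2, i4] <;> ring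
  · simp [h6]
    ring_nf

theorem wave_zero : wave (φ ω) φ' 0 0 0 0 0 = 0 := by
  ext x k
  rw [wave, pairFn_apply]
  fin_cases k <;> simp [realWave_apply, imagWave_apply]

theorem toL2_zero : toL2 (0 : 𝓢(E3, C2)) = 0 :=
  (SchwartzMap.toLpCLM ℂ C2 2 (volume : Measure E3)).map_zero

theorem hGraph_zero_iff (hβ : Differentiable ℝ β)
    (G : GroundData (potMinus β ω (φ ω)) (potPlus β ω (φ ω)) (φ ω) φ') {u : L2 C2} :
    HGraph β φ ω 0 u 0 ↔ ∃ r q c, u = toL2 (wave (φ ω) φ' r 0 0 q c) := by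
  have h0 : (0 : L2 C2) = toL2 (wave (φ ω) φ' 0 0 0 0 0) := by rw [wave_zero, toL2_zero]
  constructor
  · intro h
    rw [h0] at h
    obtain ⟨r, q, c, hu⟩ := h.exists_eq_wave hβ G
    refine ⟨r, q, c, hu.trans ?_⟩
    congr 2
    ext j
    simp
  · rintro ⟨r, q, c, rfl⟩
    rw [h0]
    convert hGraph_wave hβ G r 0 0 q c using 3
    ext j
    simp

/-- The waves contain every H-preimage of a wave, so induction on the power starting from 0 gives
one inclusion. The other holds because H² vanishes on waves. -/
theorem genKer_eq (hβ : Differentiable ℝ β)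
    (G : GroundData (potMinus β ω (φ ω)) (potPlus β ω (φ ω)) (φ ω) φ') :
    genKer β φ ω 0 = {u | ∃ r s t q c, u = toL2 (wave (φ ω) φ' r s t q c)} := by
  have hsub : ∀ n, kerPow β φ ω 0 n ⊆ {u | ∃ r s t q c, u = toL2 (wave (φ ω) φ' r s t q c)} := by
    intro n
    induction n with
    | zero =>
      rintro u (rfl : u = 0)
      exact ⟨0, 0, 0, 0, 0, by rw [wave_zero, toL2_zero]⟩
    | succ n ih =>
      rintro u ⟨f, hf, hu⟩
      obtain ⟨r, s, t, q, c, rfl⟩ := ih hf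
      obtain ⟨r', q', c', h⟩ := hu.exists_eq_wave hβ G
      exact ⟨_, _, _, _, _, h⟩
  refine Subset.antisymm (iUnion_subset fun j => hsub _) ?_
  rintro u ⟨r, s, t, q, c, rfl⟩
  -- The union is indexed from the first power, so index 1 is ker H².
  refine mem_iUnion.2 ⟨1, ⟨_, ?_, hGraph_wave hβ G r s t q c⟩⟩
  exact ⟨0, rfl, (hGraph_zero_iff hβ G).2 ⟨_, _, _, rfl⟩⟩

end Kernel

end

/-! ### Consequences of the hypotheses for φ_ω and ∂_ωφ_ω -/

noncomputable section

open Filter Topology ComplexConjugate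

/-- Evaluation at a point, on Schwartz functions. -/
def evalSchwartz (x : E3) : 𝓢(E3, ℂ) →L[ℝ] ℂ :=
  (BoundedContinuousFunction.evalCLM ℝ x).comp (SchwartzMap.toBoundedContinuousFunctionCLM ℝ E3 ℂ)

section Family

variable {γ : ℝ → 𝓢(E3, ℂ)} {γ' : 𝓢(E3, ℂ)} {ω : ℝ}

theorem hasDerivAt_eval (h : HasDerivAt γ γ' ω) (x : E3) :
    HasDerivAt (fun t => γ t x) (γ' x) ω :=
  hasDerivAt_clm_comp (evalSchwartz x) h

theorem hasDerivAt_laplacian_eval (h : HasDerivAt γ γ' ω) (x : E3) :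
    HasDerivAt (fun t => (Δ (γ t)) x) ((Δ γ') x) ω :=
  hasDerivAt_clm_comp ((evalSchwartz x).comp (LineDeriv.laplacianCLM ℝ E3 𝓢(E3, ℂ))) h

theorem hasDerivAt_toL2 (h : HasDerivAt γ γ' ω) :
    HasDerivAt (fun t => toL2 (γ t)) (toL2 γ') ω :=
  hasDerivAt_clm_comp (SchwartzMap.toLpCLM ℝ ℂ 2 (volume : Measure E3)) h

theorem hasDerivAt_norm_sq_toL2 (h : HasDerivAt γ γ' ω) :
    HasDerivAt (fun t => ‖toL2 (γ t)‖ ^ 2) (2 * inner ℝ (toL2 (γ ω)) (toL2 γ')) ω :=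
  (hasDerivAt_toL2 h).norm_sq

end Family

theorem inner_toL2_eq_re_integral {f g : 𝓢(E3, ℂ)} (hf : ∀ x, (f x).im = 0) :
    inner ℝ (toL2 f) (toL2 g) = (∫ x, f x * g x).re := by
  rw [L2.inner_def]
  have h1 := integral_re (integrable_schwartz_mul f g)
  rw [RCLike.re_to_complex] at h1
  rw [← h1]
  refine integral_congr_ae ?_
  filter_upwards [f.coeFn_toLp 2, g.coeFn_toLp 2] with x h2 h3
  rw [h2, h3, Complex.inner, Complex.conj_eq_iff_im.2 (hf x), mul_comm]
  rfl

section Hypotheses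

variable {β : ℝ → ℝ} {O : Set ℝ} {φ : ℝ → 𝓢(E3, ℂ)} {ω : ℝ}

theorem HypH1.differentiable (h1 : HypH1 β) : Differentiable ℝ β :=
  h1.2.differentiable (by simp)

theorem HypH3.im_eq_zero (h3 : HypH3 β O φ) (hω : ω ∈ O) (x : E3) : (φ ω x).im = 0 :=
  (h3.positive ω hω x).1

theorem HypH3.ne_zero (h3 : HypH3 β O φ) (hω : ω ∈ O) (x : E3) : φ ω x ≠ 0 := by
  intro h
  have := (h3.positive ω hω x).2
  rw [h] at this
  simp at this

theorem HypH3.im_deriv_eq_zero (h3 : HypH3 β O φ) (hω : ω ∈ O) {φ' : 𝓢(E3, ℂ)}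
    (hφ' : HasDerivAt φ φ' ω) (x : E3) : (φ' x).im = 0 := by
  have h1 : HasDerivAt (fun t => (φ t x).im) (φ' x).im ω :=
    Complex.imCLM.hasFDerivAt.comp_hasDerivAt ω (hasDerivAt_eval hφ' x)
  have h2 : (fun t => (φ t x).im) =ᶠ[𝓝 ω] fun _ => 0 := by
    filter_upwards [h3.isOpen.mem_nhds hω] with t ht
    exact h3.im_eq_zero ht x
  exact h1.unique ((hasDerivAt_const ω (0 : ℝ)).congr_of_eventuallyEq h2)

theorem HypH3.laplacian_eq (h3 : HypH3 β O φ) (hω : ω ∈ O) (x : E3) :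
    (Δ (φ ω)) x = potMinus β ω (φ ω) x * φ ω x := by
  have := h3.equation ω hω x
  rw [potMinus]
  push_cast
  linear_combination -this

/-- Differentiate Δφ = (ω + β(φ²))φ in ω at fixed x. As φ and φ' are real, the derivative of |φ|² is
2φφ', which turns the potential of L₋ into that of L₊. -/
theorem HypH3.laplacian_deriv_eq (h1 : HypH1 β) (h3 : HypH3 β O φ) (hω : ω ∈ O) {φ' : 𝓢(E3, ℂ)}
    (hφ' : HasDerivAt φ φ' ω) (x : E3) :
    (Δ φ') x = potPlus β ω (φ ω) x * φ' x + φ ω x := by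
  have d1 := hasDerivAt_laplacian_eval hφ' x
  have d2 := hasDerivAt_eval hφ' x
  have d3 := d2.norm_sq
  have d4 := ((h1.differentiable _).hasDerivAt.comp ω d3).ofReal_comp
  have d5 := ((hasDerivAt_id ω).ofReal_comp.add d4).mul d2
  have he : (fun t => (Δ (φ t)) x) =ᶠ[𝓝 ω] fun t =>
      (((t : ℝ) : ℂ) + ((β (‖φ t x‖ ^ 2) : ℝ) : ℂ)) * φ t x := by
    filter_upwards [h3.isOpen.mem_nhds hω] with t ht
    rw [h3.laplacian_eq ht x, potMinus]
    push_cast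
    rfl
  have d6 : HasDerivAt (fun t => (Δ (φ t)) x) _ ω := HasDerivAt.congr_of_eventuallyEq d5 he
  rw [d1.unique d6]
  obtain ⟨a, ha⟩ : ∃ a : ℝ, φ ω x = a :=
    ⟨(φ ω x).re, Complex.ext rfl (by simpa using h3.im_eq_zero hω x)⟩
  obtain ⟨b, hb⟩ : ∃ b : ℝ, φ' x = b :=
    ⟨(φ' x).re, Complex.ext rfl (by simpa using h3.im_deriv_eq_zero hω hφ' x)⟩
  simp only [potPlus, ha, hb, Complex.inner, id, Function.comp, Pi.add_apply]
  simp
  ring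

theorem bounded_potMinus (h1 : HypH1 β) (ω : ℝ) (f : 𝓢(E3, ℂ)) :
    ∃ K, ∀ x, |potMinus β ω f x| ≤ K := by
  obtain ⟨C, hC⟩ := (isCompact_Icc (a := (0 : ℝ))
    (b := (SchwartzMap.seminorm ℝ 0 0 f) ^ 2)).exists_bound_of_continuousOn
    h1.2.continuous.continuousOn
  refine ⟨|ω| + C, fun x => (abs_add_le _ _).trans (add_le_add le_rfl ?_)⟩
  refine hC _ ⟨by positivity, ?_⟩
  gcongr
  exact SchwartzMap.norm_le_seminorm ℝ f x

/-- Membership in H² is automatic once the Laplacian is in L². -/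
theorem lPlusGraph_iff {u f : L2 ℂ} :
    LPlusGraph β φ ω u f ↔ SchrodingerGraph (potPlus β ω (φ ω)) u f :=
  ⟨fun h => h.2, fun h => ⟨h.choose_spec.1.memH2, h⟩⟩

theorem integral_norm_sq_family (φ : ℝ → 𝓢(E3, ℂ)) :
    (fun s : ℝ => ∫ x : E3, ‖φ s x‖ ^ 2) = fun s => ‖toL2 (φ s)‖ ^ 2 :=
  funext fun s => integral_norm_sq_schwartz (φ s)

theorem HypH4.inner_pos (h4 : HypH4 O φ) (hω : ω ∈ O) {φ' : 𝓢(E3, ℂ)}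
    (hφ' : HasDerivAt φ φ' ω) : 0 < inner ℝ (toL2 (φ ω)) (toL2 φ') := by
  have h := h4 ω hω
  rw [integral_norm_sq_family, (hasDerivAt_norm_sq_toL2 hφ').deriv] at h
  linarith

theorem groundData (h1 : HypH1 β) (h3 : HypH3 β O φ) (h4 : HypH4 O φ) (h5 : HypH5 β O φ)
    (hω : ω ∈ O) {φ' : 𝓢(E3, ℂ)} (hφ' : HasDerivAt φ φ' ω) :
    GroundData (potMinus β ω (φ ω)) (potPlus β ω (φ ω)) (φ ω) φ' where
  im_eq_zero := h3.im_eq_zero hω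
  ne_zero := h3.ne_zero hω
  im_deriv_eq_zero := h3.im_deriv_eq_zero hω hφ'
  bounded := bounded_potMinus h1 ω (φ ω)
  laplacian := h3.laplacian_eq hω
  laplacian_deriv := h3.laplacian_deriv_eq h1 hω hφ'
  laplacian_lineDeriv := fun j => by
    -- The equation L₊∂_jφ = 0 is read off from (H5), which places ∂_jφ in the kernel; hence it
    -- holds only almost everywhere.
    have hmem : toL2 (∂_{e3 j} (φ ω) : 𝓢(E3, ℂ)) ∈ {u : L2 ℂ | LPlusGraph β φ ω u 0} := by
      rw [(h5 ω hω).2]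
      exact Submodule.subset_span ⟨j, rfl⟩
    obtain ⟨-, w, hw, hf⟩ := hmem
    obtain rfl := hw.unique (isLaplacian_toLp _)
    filter_upwards [hf, (∂_{e3 j} (φ ω) : 𝓢(E3, ℂ)).coeFn_toLp 2,
      (Δ (∂_{e3 j} (φ ω) : 𝓢(E3, ℂ))).coeFn_toLp 2, Lp.coeFn_zero ℂ 2 (volume : Measure E3)]
      with x a1 a2 a3 a4
    rw [a2, a3, a4, Pi.zero_apply] at a1
    rw [potPlus]
    linear_combination a1
  integral_mul_deriv_ne_zero := by
    have h := h4.inner_pos hω hφ'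
    rw [inner_toL2_eq_re_integral (h3.im_eq_zero hω)] at h
    intro h0
    rw [h0] at h
    simp at h
  mem_span_of_schrodingerGraph := fun u hu => by
    have hmem : u ∈ {u : L2 ℂ | LPlusGraph β φ ω u 0} := lPlusGraph_iff.2 hu
    rw [(h5 ω hω).2] at hmem
    exact hmem

end Hypotheses

end

/-! ### The coordinates p and the derivatives of Φ_p -/

noncomputable section

open Filter Topology ComplexConjugate

/-- `‖f‖²` in `L²`. -/
abbrev mass (f : 𝓢(E3, ℂ)) : ℝ := ‖toL2 f‖ ^ 2

theorem soliton_apply (φ : ℝ → 𝓢(E3, ℂ)) (ω : ℝ) (v x : E3) : soliton φ ω v x =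
    !₂[Complex.exp (Complex.I / 2 * ((inner ℝ v x : ℝ) : ℂ)) * φ ω x, 0] := by
  ext k
  fin_cases k <;> simp [soliton, vecE1]

theorem inner_e3_right (v : E3) (j : Fin 3) : inner ℝ v (e3 j) = v j := by
  simp [e3, EuclideanSpace.inner_single_right]

theorem hasFDerivAt_soliton_phase (v x : E3) :
    HasFDerivAt (fun x : E3 => Complex.exp (Complex.I / 2 * ((inner ℝ v x : ℝ) : ℂ)))
      (Complex.exp (Complex.I / 2 * ((inner ℝ v x : ℝ) : ℂ)) •
        ((Complex.I / 2) • (Complex.ofRealCLM.comp (innerSL ℝ v)))) x := by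
  have h1 : HasFDerivAt (fun x : E3 => ((inner ℝ v x : ℝ) : ℂ))
      (Complex.ofRealCLM.comp (innerSL ℝ v)) x :=
    (Complex.ofRealCLM.comp (innerSL ℝ v)).hasFDerivAt
  exact (h1.const_mul (Complex.I / 2)).cexp

theorem fderiv_soliton (φ : ℝ → 𝓢(E3, ℂ)) (ω : ℝ) (v x : E3) (j : Fin 3) :
    fderiv ℝ (soliton φ ω v) x (e3 j) =
      !₂[Complex.exp (Complex.I / 2 * ((inner ℝ v x : ℝ) : ℂ)) *
        (Complex.I / 2 * v j * φ ω x + (∂_{e3 j} (φ ω) : 𝓢(E3, ℂ)) x), 0] := by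
  have h1 := ((hasFDerivAt_soliton_phase v x).mul ((φ ω).hasFDerivAt x)).smul_const vecE1
  have h2 : HasFDerivAt (soliton φ ω v) _ x := h1
  rw [h2.fderiv, SchwartzMap.lineDerivOp_apply_eq_fderiv]
  ext k
  fin_cases k
  · simp [vecE1, inner_e3_right]
    ring
  · simp [vecE1]

section Coordinates

variable {β : ℝ → ℝ} {O : Set ℝ} {φ : ℝ → 𝓢(E3, ℂ)} {ω : ℝ}

theorem norm_phase (v x : E3) :
    conj (Complex.exp (Complex.I / 2 * ((inner ℝ v x : ℝ) : ℂ))) *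
      Complex.exp (Complex.I / 2 * ((inner ℝ v x : ℝ) : ℂ)) = 1 := by
  rw [← Complex.exp_conj, ← Complex.exp_add]
  simp [neg_div, Complex.conj_ofNat]

/-- The phase contributes v_jφ²/2 to the momentum density, while the φ∂_jφ term is purely imaginary
and drops out of the real part. -/
theorem pCoord_castSucc (him : ∀ x, (φ ω x).im = 0) (v : E3) (j : Fin 3) :
    pCoord φ (ω, v) j.castSucc = v j / 4 * mass (φ ω) := by
  have h : ∀ x, inner ℝ (diamond j.castSucc (soliton φ ω v) x) (soliton φ ω v x) =
      v j / 2 * ‖φ ω x‖ ^ 2 := by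
    intro x
    have hj : ((j.castSucc : Fin 4) : ℕ) < 3 := j.isLt
    rw [diamond, dif_pos hj, inner_C2, sigma3_apply]
    have hj' : (⟨((j.castSucc : Fin 4) : ℕ), hj⟩ : Fin 3) = j := rfl
    rw [hj', fderiv_soliton, soliton_apply]
    obtain ⟨a, ha⟩ : ∃ a : ℝ, φ ω x = a := ⟨(φ ω x).re, Complex.ext rfl (by simpa using him x)⟩
    obtain ⟨b, hb⟩ : ∃ b : ℝ, (∂_{e3 j} (φ ω) : 𝓢(E3, ℂ)) x = b :=
      ⟨_, Complex.ext rfl (by simpa using im_lineDeriv_eq_zero him (e3 j) x)⟩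
    have hE := norm_phase v x
    set E := Complex.exp (Complex.I / 2 * ((inner ℝ v x : ℝ) : ℂ))
    have h2 : (conj (-(Complex.I * (E * (Complex.I / 2 * v j * a + b)))) * (E * a)) =
        ((v j / 2 * a ^ 2 : ℝ) : ℂ) + ((b * a : ℝ) : ℂ) * Complex.I := by
      simp only [map_neg, map_mul, map_add, Complex.conj_I, Complex.conj_ofReal, map_div₀,
        Complex.conj_ofNat]
      push_cast
      linear_combination (-(-Complex.I * (-Complex.I / 2 * v j * a + b)) * a) * hE +
        (-(v j : ℂ) * a ^ 2 / 2) * Complex.I_sq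
    simp only [ha, hb]
    simp only [PiLp.neg_apply, PiLp.smul_apply, smul_eq_mul]
    simp only [Matrix.cons_val_zero, Matrix.cons_val_one]
    rw [h2]
    simp [-Complex.ofReal_pow]
  rw [pCoord, charge]
  simp only [h]
  rw [integral_const_mul, integral_norm_sq_schwartz]
  ring

theorem pCoord_last (v : E3) : pCoord φ (ω, v) (Fin.last 3) = mass (φ ω) / 2 := by
  have h : ∀ x, inner ℝ (diamond (Fin.last 3) (soliton φ ω v) x) (soliton φ ω v x) =
      ‖φ ω x‖ ^ 2 := by
    intro x
    rw [diamond, dif_neg (by simp), real_inner_self_eq_norm_sq, EuclideanSpace.norm_sq_eq,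
      soliton_apply]
    have h1 : Complex.I / 2 * ((inner ℝ v x : ℝ) : ℂ) =
        ((inner ℝ v x / 2 : ℝ) : ℂ) * Complex.I := by
      push_cast
      ring
    have h2 : ‖Complex.exp (Complex.I / 2 * ((inner ℝ v x : ℝ) : ℂ))‖ = 1 := by
      rw [h1, Complex.norm_exp_ofReal_mul_I]
    simp [h2]
  rw [pCoord, charge]
  simp only [h]
  rw [integral_norm_sq_schwartz]
  ring

theorem HypH3.mass_pos (h3 : HypH3 β O φ) (hω : ω ∈ O) : 0 < mass (φ ω) := by
  refine pow_pos (norm_pos_iff.2 fun h => ?_) 2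
  have h1 : toL2 (φ ω) = toL2 0 :=
    h.trans (SchwartzMap.toLpCLM ℂ ℂ 2 (volume : Measure E3)).map_zero.symm
  have h2 := SchwartzMap.injective_toLp 2 (volume : Measure E3) h1
  exact h3.ne_zero hω 0 (by rw [h2]; rfl)

theorem strictMonoOn_mass (h3 : HypH3 β O φ) (h4 : HypH4 O φ) :
    StrictMonoOn (fun t => mass (φ t)) O := by
  obtain ⟨D, hD0, hD⟩ := h3.smooth
  have hd : ∀ t ∈ O, HasDerivAt φ (D 1 t) t := fun t ht => hD0 ▸ hD 0 t ht
  refine strictMonoOn_of_deriv_pos h3.interval.convex (fun t ht =>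
    (hasDerivAt_norm_sq_toL2 (hd t ht)).continuousAt.continuousWithinAt) fun t ht => ?_
  have h := h4 t (interior_subset ht)
  rwa [integral_norm_sq_family] at h

/-- The last coordinate is half the mass, which determines ω by monotonicity; dividing the others by
the positive mass recovers v. -/
theorem injOn_pCoord (h3 : HypH3 β O φ) (h4 : HypH4 O φ) :
    InjOn (pCoord φ) (O ×ˢ univ) := by
  rintro ⟨t, v⟩ ⟨ht, -⟩ ⟨t', v'⟩ ⟨ht', -⟩ h
  simp only at ht ht'
  have h1 := congrFun h (Fin.last 3)
  rw [pCoord_last, pCoord_last] at h1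
  obtain rfl : t = t' := (strictMonoOn_mass h3 h4).injOn ht ht' (by simpa using h1)
  congr 1
  ext j
  have h2 := congrFun h j.castSucc
  rw [pCoord_castSucc (h3.im_eq_zero ht), pCoord_castSucc (h3.im_eq_zero ht)] at h2
  have h5 := mul_right_cancel₀ (h3.mass_pos ht).ne' h2
  linarith

theorem PhiP_pCoord (h3 : HypH3 β O φ) (h4 : HypH4 O φ) (hω : ω ∈ O) (v : E3) :
    PhiP φ O (pCoord φ (ω, v)) = soliton φ ω v := by
  have h := (injOn_pCoord h3 h4).leftInvOn_invFunOn (show (ω, v) ∈ O ×ˢ univ from ⟨hω, trivial⟩)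
  rw [PhiP, h]

/-- Keeping p₄ fixed keeps the mass, so ω can stay fixed and p_j = v_j‖φ‖²/4 is solved for v_j. -/
theorem pCoord_add_castSucc (h3 : HypH3 β O φ) (hω : ω ∈ O) (j : Fin 3) (s : ℝ) :
    pCoord φ (ω, 0) + s • Pi.single j.castSucc 1 =
      pCoord φ (ω, (4 * s / mass (φ ω)) • e3 j) := by
  have hm := (h3.mass_pos hω).ne'
  ext k
  induction k using Fin.lastCases with
  | last =>
    rw [Pi.add_apply, pCoord_last, pCoord_last, Pi.smul_apply,
      Pi.single_eq_of_ne (Fin.castSucc_lt_last j).ne', smul_zero, add_zero]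
  | cast k =>
    rw [Pi.add_apply, pCoord_castSucc (h3.im_eq_zero hω), pCoord_castSucc (h3.im_eq_zero hω)]
    by_cases hk : k = j
    · subst hk
      generalize mass (φ ω) = m at hm
      simp [e3]
      field_simp
    · have : (k.castSucc : Fin 4) ≠ j.castSucc := fun h => hk (Fin.castSucc_injective 3 h)
      simp [e3, hk, this]

theorem pCoord_add_last (h3 : HypH3 β O φ) (hω : ω ∈ O) {t s : ℝ} (ht : t ∈ O)
    (hts : mass (φ t) = mass (φ ω) + 2 * s) :
    pCoord φ (ω, 0) + s • Pi.single (Fin.last 3) 1 = pCoord φ (t, 0) := by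
  ext k
  induction k using Fin.lastCases with
  | last =>
    rw [Pi.add_apply, pCoord_last, pCoord_last, Pi.smul_apply, Pi.single_eq_same, hts, smul_eq_mul]
    ring
  | cast k =>
    rw [Pi.add_apply, pCoord_castSucc (h3.im_eq_zero hω), pCoord_castSucc (h3.im_eq_zero ht)]
    rw [Pi.smul_apply, Pi.single_eq_of_ne (Fin.castSucc_lt_last k).ne]
    simp

theorem hasDerivAt_PhiP_castSucc (h3 : HypH3 β O φ) (h4 : HypH4 O φ) (hω : ω ∈ O) (j : Fin 3)
    (x : E3) :
    HasDerivAt (fun s : ℝ => PhiP φ O (pCoord φ (ω, 0) + s • Pi.single j.castSucc 1) x)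
      !₂[Complex.I * ((2 / mass (φ ω) : ℝ) * (x j * φ ω x)), 0] 0 := by
  have h1 : (fun s : ℝ => PhiP φ O (pCoord φ (ω, 0) + s • Pi.single j.castSucc 1) x) =
      fun s : ℝ => (Complex.exp (Complex.I / 2 * ((4 * s / mass (φ ω) * x j : ℝ) : ℂ)) *
        φ ω x) • vecE1 := by
    ext1 s
    rw [pCoord_add_castSucc h3 hω, PhiP_pCoord h3 h4 hω, soliton, inner_smul_left,
      real_inner_comm, inner_e3_right]
    simp
  rw [h1]
  have h2 : HasDerivAt (fun s : ℝ => 4 * s / mass (φ ω) * x j) (4 / mass (φ ω) * x j) 0 := by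
    simpa using (((hasDerivAt_id (0 : ℝ)).const_mul 4).div_const (mass (φ ω))).mul_const (x j)
  have h5 := (((h2.ofReal_comp.const_mul (Complex.I / 2)).cexp).mul_const (φ ω x)).smul_const vecE1
  refine h5.congr_deriv ?_
  ext k
  fin_cases k
  · simp [vecE1]
    ring
  · simp [vecE1]

theorem hasDerivAt_PhiP_last (h3 : HypH3 β O φ) (h4 : HypH4 O φ) (hω : ω ∈ O) {D : ℕ → ℝ → 𝓢(E3, ℂ)}
    (hD0 : D 0 = φ) (hD : ∀ k : ℕ, ∀ ω ∈ O, HasDerivAt (D k) (D (k + 1) ω) ω) (x : E3) :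
    HasDerivAt (fun s : ℝ => PhiP φ O (pCoord φ (ω, 0) + s • Pi.single (Fin.last 3) 1) x)
      !₂[((inner ℝ (toL2 (φ ω)) (toL2 (D 1 ω)))⁻¹ : ℝ) * D 1 ω x, 0] 0 := by
  have hd : ∀ t ∈ O, HasDerivAt φ (D 1 t) t := fun t ht => hD0 ▸ hD 0 t ht
  have hO := h3.isOpen.mem_nhds hω
  have hpos := h4.inner_pos hω (hd ω hω)
  set i₀ := inner ℝ (toL2 (φ ω)) (toL2 (D 1 ω)) with hi₀
  -- The inverse function theorem needs strict differentiability of the mass. Continuity of its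
  -- derivative comes from the second ω-derivative of the family.
  have hstrict : HasStrictDerivAt (fun t => mass (φ t)) (2 * i₀) ω := by
    refine hasStrictDerivAt_of_hasDerivAt_of_continuousAt
      (f' := fun t => 2 * inner ℝ (toL2 (φ t)) (toL2 (D 1 t))) ?_ ?_
    · filter_upwards [hO] with t ht
      exact hasDerivAt_norm_sq_toL2 (hd t ht)
    · exact continuousAt_const.mul ((hasDerivAt_toL2 (hd ω hω)).continuousAt.inner
        (hasDerivAt_toL2 (hD 1 ω hω)).continuousAt)
  have hne : 2 * i₀ ≠ 0 := by positivity
  set g := hstrict.localInverse _ _ _ hne with hg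
  have hg1 := (hstrict.to_localInverse hne).hasDerivAt
  have hgω : g (mass (φ ω)) = ω := HasStrictFDerivAt.localInverse_apply_image _
  have hlin : HasDerivAt (fun s : ℝ => mass (φ ω) + 2 * s) 2 0 := by
    simpa using ((hasDerivAt_id (0 : ℝ)).const_mul 2).const_add (mass (φ ω))
  have hlin0 : mass (φ ω) + 2 * (0 : ℝ) = mass (φ ω) := by ring
  have hg2 : HasDerivAt (fun s : ℝ => g (mass (φ ω) + 2 * s)) ((2 * i₀)⁻¹ * 2) 0 := by
    refine HasDerivAt.comp (0 : ℝ) ?_ hlin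
    rw [hlin0]
    exact hg1
  have hright : ∀ᶠ s : ℝ in 𝓝 0, mass (φ (g (mass (φ ω) + 2 * s))) = mass (φ ω) + 2 * s := by
    have h := HasStrictFDerivAt.eventually_right_inverse (hstrict.hasStrictFDerivAt_equiv hne)
    have ht : Tendsto (fun s : ℝ => mass (φ ω) + 2 * s) (𝓝 0) (𝓝 (mass (φ ω))) := by
      have := hlin.continuousAt.tendsto
      rwa [hlin0] at this
    exact ht.eventually h
  have hmem : ∀ᶠ s : ℝ in 𝓝 0, g (mass (φ ω) + 2 * s) ∈ O := by
    have := hg2.continuousAt.tendsto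
    rw [hlin0, hgω] at this
    exact this.eventually hO
  -- Since p is injective, the chosen global inverse in `PhiP` agrees near s = 0 with the local
  -- inverse g of the mass.
  have he : (fun s : ℝ => PhiP φ O (pCoord φ (ω, 0) + s • Pi.single (Fin.last 3) 1) x) =ᶠ[𝓝 0]
      fun s : ℝ => (φ (g (mass (φ ω) + 2 * s)) x) • vecE1 := by
    filter_upwards [hright, hmem] with s h5 h6
    rw [pCoord_add_last h3 hω h6 h5, PhiP_pCoord h3 h4 h6]
    simp [soliton]
  have hev : HasDerivAt (fun t => φ t x) (D 1 ω x) (g (mass (φ ω) + 2 * (0 : ℝ))) := by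
    rw [hlin0, hgω]
    exact hasDerivAt_eval (hd ω hω) x
  have h7 := (hev.scomp (0 : ℝ) hg2).smul_const vecE1
  refine (HasDerivAt.congr_of_eventuallyEq h7 he).congr_deriv ?_
  have h8 : (2 * i₀)⁻¹ * 2 = i₀⁻¹ := by
    field_simp
  rw [h8]
  ext k
  fin_cases k <;> simp [vecE1]

end Coordinates

end

/-! ### The ten tangent vectors as a basis of the waves -/

noncomputable section

open Filter Topology ComplexConjugate

/-- The parameters `(r, s, t, q, c)` of a wave. -/
abbrev WaveParam : Type := (Fin 3 → ℝ) × ℝ × (Fin 3 → ℝ) × ℝ × ℂ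

theorem wave_apply (φ φ' : 𝓢(E3, ℂ)) (r : Fin 3 → ℝ) (s : ℝ) (t : Fin 3 → ℝ) (q : ℝ) (c : ℂ)
    (x : E3) : wave φ φ' r s t q c x =
      !₂[∑ j, (r j : ℂ) * (∂_{e3 j} φ : 𝓢(E3, ℂ)) x + s * φ' x +
        Complex.I * (∑ j, (t j : ℂ) * ((x j : ℂ) * φ x) + q * φ x), c * φ x] := by
  simp [wave, pairFn_apply, realWave_apply, imagWave_apply]

/-- `wave` as a linear function of its parameters. -/
def waveLin (φ φ' : 𝓢(E3, ℂ)) : WaveParam →ₗ[ℝ] 𝓢(E3, C2) where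
  toFun p := wave φ φ' p.1 p.2.1 p.2.2.1 p.2.2.2.1 p.2.2.2.2
  map_add' p p' := by
    ext x k
    simp only [add_apply, wave_apply, Fin.sum_univ_three]
    fin_cases k
    · simp
      ring
    · simp
      ring
  map_smul' a p := by
    ext x k
    simp only [smul_apply, wave_apply, Fin.sum_univ_three]
    fin_cases k
    · simp
      ring
    · simp
      ring

/-- `wave` as a linear map into `L²`. -/
def waveMap (φ φ' : 𝓢(E3, ℂ)) : WaveParam →ₗ[ℝ] L2 C2 :=
  (SchwartzMap.toLpCLM ℝ C2 2 (volume : Measure E3)).toLinearMap ∘ₗ waveLin φ φ'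

/-- Reality of φ and φ' separates the first component into real and imaginary waves. Pairing the
real one with φ and then x_kφ kills s and r; pairing the imaginary one with ∂_kφ kills t. Evaluation
at the origin, where φ ≠ 0, kills q and c. -/
theorem GroundData.ker_waveMap {V Vp : E3 → ℝ} {φ φ' : 𝓢(E3, ℂ)} (G : GroundData V Vp φ φ') :
    LinearMap.ker (waveMap φ φ') = ⊥ := by
  rw [LinearMap.ker_eq_bot']
  rintro ⟨r, s, t, q, c⟩ h
  have h0 : wave φ φ' r s t q c = 0 :=
    SchwartzMap.injective_toLp 2 (volume : Measure E3)
      (h.trans (SchwartzMap.toLpCLM ℝ C2 2 (volume : Measure E3)).map_zero.symm)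
  have hx : ∀ x, realWave φ φ' r s x + Complex.I * imagWave φ t q x = 0 ∧ c * φ x = 0 := by
    intro x
    have h1 : wave φ φ' r s t q c x = 0 := by rw [h0]; rfl
    rw [wave, pairFn_apply] at h1
    exact ⟨by simpa using congrArg (fun z : C2 => z 0) h1,
      by simpa using congrArg (fun z : C2 => z 1) h1⟩
  have hre : ∀ x, realWave φ φ' r s x = 0 := fun x => by
    have h1 := congrArg Complex.re (hx x).1
    exact Complex.ext (by simpa [G.im_imagWave t q x] using h1) (G.im_realWave r s x)
  have him : ∀ x, imagWave φ t q x = 0 := fun x => by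
    simpa [hre x] using (hx x).1
  obtain rfl : s = 0 := by
    have h1 := integral_self_mul_realWave (φ := φ) (φ' := φ') r s
    simpa [hre, G.integral_mul_deriv_ne_zero] using h1
  obtain rfl : r = 0 := by
    ext k
    have h1 := integral_mul_realWave φ φ' (coordMul k φ) r 0
    simpa [hre, integral_coordMul_mul_lineDeriv, G.integral_mul_self_ne_zero] using h1
  obtain rfl : t = 0 := by
    ext k
    have h1 := integral_lineDeriv_mul_imagWave (φ := φ) t q k
    simpa [him, G.integral_mul_self_ne_zero] using h1.symm
  have hq := him 0
  rw [imagWave_apply] at hq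
  have hc := (hx 0).2
  simp [G.ne_zero 0] at hq hc
  simp [hq, hc]

/-- The parameters of the ten tangent vectors. -/
def tangentParam (κ κ' : ℝ) : Fin 10 → WaveParam :=
  ![(0, 0, κ • Pi.single 0 1, 0, 0), (0, 0, κ • Pi.single 1 1, 0, 0),
    (0, 0, κ • Pi.single 2 1, 0, 0), (0, κ', 0, 0, 0),
    (Pi.single 0 1, 0, 0, 0, 0), (Pi.single 1 1, 0, 0, 0, 0), (Pi.single 2 1, 0, 0, 0, 0),
    -- Here σ₂CΦ = (0, iφ), so that iσ₂CΦ = (0, -φ), and iΦ = (iφ, 0).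
    (0, 0, 0, 0, -1), (0, 0, 0, 0, Complex.I), (0, 0, 0, 1, 0)]

theorem linearIndependent_tangentParam {κ κ' : ℝ} (h : κ ≠ 0) (h' : κ' ≠ 0) :
    LinearIndependent ℝ (tangentParam κ κ') := by
  rw [Fintype.linearIndependent_iff]
  intro g hg
  simp only [Fin.sum_univ_succ, Fin.sum_univ_zero, tangentParam, Matrix.cons_val_zero,
    Matrix.cons_val_succ, Prod.smul_mk, Prod.mk_add_mk, Prod.mk_eq_zero, add_zero, smul_zero,
    zero_add] at hg
  obtain ⟨hr, hs, ht, hq, hc⟩ := hg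
  have r0 := congrFun hr 0
  have r1 := congrFun hr 1
  have r2 := congrFun hr 2
  have t0 := congrFun ht 0
  have t1 := congrFun ht 1
  have t2 := congrFun ht 2
  have c0 := congrArg Complex.re hc
  have c1 := congrArg Complex.im hc
  simp [h, h'] at r0 r1 r2 t0 t1 t2 c0 c1 hs hq
  intro i
  fin_cases i <;> assumption

/-- Dimension count: the parameter space has real dimension 3 + 1 + 3 + 1 + 2 = 10. -/
theorem span_tangentParam {κ κ' : ℝ} (h : κ ≠ 0) (h' : κ' ≠ 0) :
    Submodule.span ℝ (range (tangentParam κ κ')) = ⊤ :=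
  (linearIndependent_tangentParam h h').span_eq_top_of_card_eq_finrank' (by simp)

section Tangent

variable {β : ℝ → ℝ} {O : Set ℝ} {φ : ℝ → 𝓢(E3, ℂ)} {ω : ℝ}

theorem dxPhi_eq (h3 : HypH3 β O φ) (h4 : HypH4 O φ) (hω : ω ∈ O) (j : Fin 3) (x : E3) :
    dxPhi φ O (pCoord φ (ω, 0)) j x = !₂[(∂_{e3 j} (φ ω) : 𝓢(E3, ℂ)) x, 0] := by
  rw [dxPhi, PhiP_pCoord h3 h4 hω, fderiv_soliton]
  simp

theorem tangentVector_eq (h3 : HypH3 β O φ) (h4 : HypH4 O φ) (hω : ω ∈ O)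
    {D : ℕ → ℝ → 𝓢(E3, ℂ)} (hD0 : D 0 = φ)
    (hD : ∀ k : ℕ, ∀ ω ∈ O, HasDerivAt (D k) (D (k + 1) ω) ω) (i : Fin 10) :
    tangentVector φ O (pCoord φ (ω, 0)) i = waveLin (φ ω) (D 1 ω) (tangentParam
      (2 / mass (φ ω)) (inner ℝ (toL2 (φ ω)) (toL2 (D 1 ω)))⁻¹ i) := by
  have hp := fun (j : Fin 3) x => (hasDerivAt_PhiP_castSucc h3 h4 hω j x).deriv
  have hl := fun x => (hasDerivAt_PhiP_last h3 h4 hω hD0 hD x).deriv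
  have him := h3.im_eq_zero hω
  have hconj : ∀ x, conj (φ ω x) = φ ω x := fun x => Complex.conj_eq_iff_im.2 (him x)
  have h0 : ∀ x, dpPhi φ O (pCoord φ (ω, 0)) 0 x = _ := hp 0
  have h1 : ∀ x, dpPhi φ O (pCoord φ (ω, 0)) 1 x = _ := hp 1
  have h2 : ∀ x, dpPhi φ O (pCoord φ (ω, 0)) 2 x = _ := hp 2
  have h5 : ∀ x, dpPhi φ O (pCoord φ (ω, 0)) 3 x = _ := hl
  have hd := fun j x => dxPhi_eq h3 h4 hω j x
  have hs : ∀ x, PhiP φ O (pCoord φ (ω, 0)) x = !₂[φ ω x, 0] := fun x => by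
    rw [PhiP_pCoord h3 h4 hω, soliton_zero]
  generalize 2 / mass (φ ω) = κ at *
  generalize (inner ℝ (toL2 (φ ω)) (toL2 (D 1 ω)))⁻¹ = κ' at *
  funext x
  rw [show waveLin (φ ω) (D 1 ω) (tangentParam κ κ' i) x = _ from wave_apply _ _ _ _ _ _ _ x]
  fin_cases i
  · refine (h0 x).trans ?_
    simp [tangentParam, Fin.sum_univ_three]
  · refine (h1 x).trans ?_
    simp [tangentParam, Fin.sum_univ_three]
  · refine (h2 x).trans ?_
    simp [tangentParam, Fin.sum_univ_three]
  · refine (h5 x).trans ?_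
    simp [tangentParam]
  · refine (hd 0 x).trans ?_
    simp [tangentParam, Fin.sum_univ_three]
  · refine (hd 1 x).trans ?_
    simp [tangentParam, Fin.sum_univ_three]
  · refine (hd 2 x).trans ?_
    simp [tangentParam, Fin.sum_univ_three]
  · change Complex.I • sigma2 (conjC (PhiP φ O (pCoord φ (ω, 0)) x)) = _
    rw [hs, sigma2_apply]
    ext k
    fin_cases k <;> simp [tangentParam, conjC, hconj, ← mul_assoc]
  · change sigma2 (conjC (PhiP φ O (pCoord φ (ω, 0)) x)) = _
    rw [hs, sigma2_apply]
    ext k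
    fin_cases k <;> simp [tangentParam, conjC, hconj]
  · change Complex.I • PhiP φ O (pCoord φ (ω, 0)) x = _
    rw [hs]
    ext k
    fin_cases k <;> simp [tangentParam]

end Tangent

/-! ### The infinitesimal orbit -/

theorem hasDerivAt_orbitCurve (τ : E3) (A : C2 →L[ℝ] C2) {f : E3 → C2} {x : E3}
    (hf : DifferentiableAt ℝ f x) :
    HasDerivAt (fun t : ℝ => orbitCurve τ A f t x) (A (f x) + fderiv ℝ f x τ) 0 := by
  have h0 : NormedSpace.exp ((0 : ℝ) • A) = 1 := by
    have h : (0 : ℝ) • A = 0 := zero_smul ℝ A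
    rw [h, NormedSpace.exp_zero]
  have h1 : HasDerivAt (fun t : ℝ => NormedSpace.exp (t • A)) A 0 := by
    refine (hasDerivAt_exp_smul_const (𝕂 := ℝ) A (0 : ℝ)).congr_deriv ?_
    rw [h0, one_mul]
  have h2 : HasDerivAt (fun t : ℝ => x + t • τ) τ 0 := by
    simpa using ((hasDerivAt_id (0 : ℝ)).smul_const τ).const_add x
  have h3 : HasDerivAt (fun t : ℝ => f (x + t • τ)) (fderiv ℝ f x τ) 0 := by
    refine HasFDerivAt.comp_hasDerivAt (0 : ℝ) (f := fun t : ℝ => x + t • τ) ?_ h2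
    simpa using hf.hasFDerivAt
  refine (h1.clm_apply h3).congr_deriv ?_
  rw [h0, zero_smul, add_zero, one_apply_eq_self]

/-- The elements `(z₀, z₁) ↦ (i q z₀ - c (conj z₁), c (conj z₀))` of the centralizer of `iσ₃`
in `so(4)`. -/
def centralizerGen (q : ℝ) (c : ℂ) : C2 →L[ℝ] C2 :=
  LinearMap.toContinuousLinearMap
    { toFun := fun z => !₂[Complex.I * q * z 0 - c * conj (z 1), c * conj (z 0)]
      map_add' := fun z w => by
        ext k
        fin_cases k <;> simp <;> ring
      map_smul' := fun a z => by
        ext k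
        fin_cases k <;> simp <;> ring }

theorem centralizerGen_apply (q : ℝ) (c : ℂ) (z : C2) : centralizerGen q c z =
    !₂[Complex.I * q * z 0 - c * conj (z 1), c * conj (z 0)] := rfl

theorem isSo4_centralizerGen (q : ℝ) (c : ℂ) : IsSo4 (centralizerGen q c) := by
  intro z w
  rw [inner_C2, inner_C2, centralizerGen_apply, centralizerGen_apply]
  simp
  ring

theorem commutesISigma3_centralizerGen (q : ℝ) (c : ℂ) :
    CommutesISigma3 (centralizerGen q c) := by
  intro z
  rw [sigma3_apply, sigma3_apply, centralizerGen_apply, centralizerGen_apply]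
  ext k
  fin_cases k <;> simp <;> ring

theorem IsSo4.apply_vecE1_re {A : C2 →L[ℝ] C2} (hA : IsSo4 A) : (A vecE1 0).re = 0 := by
  have h := hA vecE1 vecE1
  rw [inner_C2, inner_C2] at h
  simp [vecE1] at h
  exact self_eq_neg.1 h

theorem fderiv_soliton_zero (φ : ℝ → 𝓢(E3, ℂ)) (ω : ℝ) (x τ : E3) :
    fderiv ℝ (soliton φ ω 0) x τ =
      !₂[∑ j, (τ j : ℂ) * (∂_{e3 j} (φ ω) : 𝓢(E3, ℂ)) x, 0] := by
  have hτ : τ = ∑ j, τ j • e3 j := by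
    ext k
    fin_cases k <;> simp [Fin.sum_univ_three, e3]
  conv_lhs => rw [hτ]
  simp only [map_sum, map_smul, fderiv_soliton]
  ext k
  fin_cases k <;> simp [Fin.sum_univ_three]

theorem differentiable_soliton (φ : ℝ → 𝓢(E3, ℂ)) (ω : ℝ) (v : E3) :
    Differentiable ℝ (soliton φ ω v) := fun x =>
  (((hasFDerivAt_soliton_phase v x).mul
    ((φ ω).hasFDerivAt x)).smul_const vecE1).differentiableAt

theorem hasDerivAt_orbitCurve_soliton {φ : ℝ → 𝓢(E3, ℂ)} {ω : ℝ} (him : ∀ x, (φ ω x).im = 0)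
    (φ' : 𝓢(E3, ℂ)) (τ : E3) {A : C2 →L[ℝ] C2} (hA : IsSo4 A) (x : E3) :
    HasDerivAt (fun t : ℝ => orbitCurve τ A (soliton φ ω 0) t x)
      (wave (φ ω) φ' τ 0 0 (A vecE1 0).im (A vecE1 1) x) 0 := by
  refine (hasDerivAt_orbitCurve τ A (differentiable_soliton φ ω 0 x)).congr_deriv ?_
  obtain ⟨a, ha⟩ : ∃ a : ℝ, φ ω x = a := ⟨(φ ω x).re, Complex.ext rfl (by simpa using him x)⟩
  have h1 : soliton φ ω 0 x = a • vecE1 := by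
    rw [soliton_zero, ha]
    ext k
    fin_cases k <;> simp [vecE1]
  have h0 : A vecE1 0 = (A vecE1 0).im * Complex.I := by
    apply Complex.ext <;> simp [hA.apply_vecE1_re]
  rw [fderiv_soliton_zero, h1, map_smul, wave_apply, ha]
  ext k
  fin_cases k
  · simp
    rw [h0]
    simp
    ring
  · simp
    ring

/-- Φ is a real multiple of e₁ at each point, so A enters only through A e₁. Skewness makes its
first entry imaginary and leaves the second free. Commuting with iσ₃ restricts A e₁ no further, as
`centralizerGen` attains all these values. -/
theorem orbitTangent_soliton {φ : ℝ → 𝓢(E3, ℂ)} {ω : ℝ} (him : ∀ x, (φ ω x).im = 0)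
    (φ' : 𝓢(E3, ℂ)) : orbitTangent (soliton φ ω 0) =
      {u | ∃ r q c, u = toL2 (wave (φ ω) φ' r 0 0 q c)} := by
  ext u
  constructor
  · rintro ⟨τ, A, hA, -, h⟩
    refine ⟨τ, (A vecE1 0).im, A vecE1 1, Lp.ext ?_⟩
    filter_upwards [h, (wave (φ ω) φ' τ 0 0 (A vecE1 0).im (A vecE1 1)).coeFn_toLp 2] with x h1 h2
    rw [h2]
    exact h1.unique (hasDerivAt_orbitCurve_soliton him φ' τ hA x)
  · rintro ⟨r, q, c, rfl⟩
    refine ⟨WithLp.toLp 2 r, centralizerGen q c, isSo4_centralizerGen q c,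
      commutesISigma3_centralizerGen q c, ?_⟩
    filter_upwards [(wave (φ ω) φ' r 0 0 q c).coeFn_toLp 2] with x h2
    rw [h2]
    have h := hasDerivAt_orbitCurve_soliton him φ' (WithLp.toLp 2 r) (isSo4_centralizerGen q c) x
    simpa [centralizerGen_apply, vecE1] using h

end

theorem mainTheorem5 (β : ℝ → ℝ) (O : Set ℝ) (φ : ℝ → 𝓢(E3, ℂ))
    (h1 : HypH1 β) (h2 : HypH2 β) (h3 : HypH3 β O φ) (h4 : HypH4 O φ) (h5 : HypH5 β O φ)
    (ω : ℝ) (hω : ω ∈ O) :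
    (∀ (j : Fin 4) (x : E3), DifferentiableAt ℝ
      (fun s : ℝ => PhiP φ O (pCoord φ (ω, 0) + s • Pi.single j 1) x) 0) ∧
    (∃ b : Fin 10 → L2 C2,
      (∀ i, b i =ᵐ[volume] tangentVector φ O (pCoord φ (ω, 0)) i) ∧
      LinearIndependent ℝ b ∧
      (Submodule.span ℝ (range b) : Set (L2 C2)) = genKer β φ ω 0) ∧
    orbitTangent (PhiP φ O (pCoord φ (ω, 0))) = {u : L2 C2 | HGraph β φ ω 0 u 0} := by
  obtain ⟨D, hD0, hD⟩ := h3.smooth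
  have hd : HasDerivAt φ (D 1 ω) ω := hD0 ▸ hD 0 ω hω
  have G := groundData h1 h3 h4 h5 hω hd
  refine ⟨fun j x => ?_, ?_, ?_⟩
  · induction j using Fin.lastCases with
    | last => exact (hasDerivAt_PhiP_last h3 h4 hω hD0 hD x).differentiableAt
    | cast j => exact (hasDerivAt_PhiP_castSucc h3 h4 hω j x).differentiableAt
  · have hκ : 2 / mass (φ ω) ≠ 0 := (div_pos two_pos (h3.mass_pos hω)).ne'
    have hκ' := inv_ne_zero (h4.inner_pos hω hd).ne'
    refine ⟨waveMap (φ ω) (D 1 ω) ∘ tangentParam (2 / mass (φ ω))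
      (inner ℝ (toL2 (φ ω)) (toL2 (D 1 ω)))⁻¹, fun i => ?_,
      (linearIndependent_tangentParam hκ hκ').map' _ G.ker_waveMap, ?_⟩
    · rw [tangentVector_eq h3 h4 hω hD0 hD]
      exact SchwartzMap.coeFn_toLp _ 2 volume
    -- The ten parameters span the parameter space, so the span of the vectors is the whole range of
    -- `waveMap`, that is, all waves.
    · rw [range_comp, Submodule.span_image, span_tangentParam hκ hκ', Submodule.map_top,
        genKer_eq h1.differentiable G]
      ext u
      constructor
      · rintro ⟨⟨r, s, t, q, c⟩, rfl⟩
        exact ⟨r, s, t, q, c, rfl⟩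
      · rintro ⟨r, s, t, q, c, rfl⟩
        exact ⟨(r, s, t, q, c), rfl⟩
  · rw [PhiP_pCoord h3 h4 hω, orbitTangent_soliton (h3.im_eq_zero hω) (D 1 ω)]
    ext u
    exact (hGraph_zero_iff h1.differentiable G).symm
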